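/- All vector spaces are over $\mathbb{C}$. A nonlocal vertex algebra is a vector space $V$ with a vacuum vector $\mathbf 1$ and a linear map $Y(\cdot,x)\colon V\to \mathrm{Hom}(V,V((x)))$, $Y(v,x)=\sum_{n\in\mathbb Z}v_nx^{-n-1}$, such that $Y(\mathbf 1,x)v=v$, $Y(v,x)\mathbf 1\in V[[x]]$ has constant term $v$, and for all $u,v,w\in V$ there is an integer $l\ge 0$ with $$(x_0+x_2)^lY(u,x_0+x_2)Y(v,x_2)w=(x_0+x_2)^lY(Y(u,x_0)v,x_2)w,$$ where powers of $x_0+x_2$ are expanded in nonnegative powers of $x_2$. $V$ is called nondegenerate if for every integer $n\ge 1$ the linear map $$Z_n\colon V^{\otimes n}\otimes\mathbb C((x_1))\cdots((x_n))\to V((x_1))\cdots((x_n)),\quad u_1\otimes\cdots\otimes u_n\otimes f\mapsto f\,Y(u_1,x_1)\cdots Y(u_n,x_n)\mathbf 1$$ is injective. A compatible filtration of $V$ is an increasing family $E=\{E_n\}_{n\in\mathbb Z}$ of subspaces with $\bigcup_nE_n=V$, $\mathbf 1\in E_0$, and $u_kv\in E_{m+n}$ for all $u\in E_m$, $v\in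 E_n$ and $k,m,n\in\mathbb Z$. Then $\mathrm{gr}_E(V)=\bigoplus_{n\in\mathbb Z}E_n/E_{n-1}$ is a nonlocal vertex algebra with vacuum $\mathbf 1+E_{-1}$ and products $(u+E_{m-1})_k(v+E_{n-1})=u_kv+E_{m+n-1}$ for $u\in E_m$, $v\in E_n$. For a vector space $U$, let $FCD(U)=S(\mathbb C[\partial]\otimes U)$ be the symmetric algebra, with the derivation $\partial$ that extends multiplication by $\partial$ on $\mathbb C[\partial]\otimes U$; it is a nonlocal vertex algebra with vacuum $1$ and $Y(a,x)b=(e^{x\partial}a)b$. Let $V$ be a nonlocal vertex algebra. 1. If $V$ has a compatible filtration $E$ that is lower truncated (there is $r\in\mathbb Z$ with $E_n=0$ for all $n<r$) such that $\mathrm{gr}_E(V)$ is nondegenerate, then $V$ is nondegenerate. 2. If $V$ has countable dimension, and there are a compatible filtration $E$ of $V$ with $E_n=0$ for all $n<0$ and a vector space $U$ such that $\mathrm{gr}_E(V)$ is isomorphic to $FCD(U)$ as a nonlocal vertex algebra, then $V$ is nondegenerate. -/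

import Mathlib

noncomputable section

open scoped TensorProduct

/-! ### Nonlocal vertex algebras -/

/-- Let `Y(u, x) = ∑ₙ uₙ x^(-n-1)` where `mode n u v = uₙ v`. This is the coefficient of `x₀ᵖ x₂^q` in
`(x₀ + x₂)ˡ Y(u, x₀ + x₂) Y(v, x₂) w`, where powers of `x₀ + x₂` are expanded in nonnegative
powers of `x₂`. The sum is finite as soon as `vₙ w = 0` for `n` large. -/
def assocLeft {V : Type*} [AddCommGroup V] [Module ℂ V] (mode : ℤ → V →ₗ[ℂ] V →ₗ[ℂ] V)
    (l : ℕ) (p q : ℤ) (u v w : V) : V :=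
  ∑ᶠ j : ℕ, Ring.choose (p + j) j • mode (l - 1 - j - p) u (mode (j - 1 - q) v w)

/-- The coefficient of `x₀ᵖ x₂^q` in `(x₀ + x₂)ˡ Y(Y(u, x₀) v, x₂) w`. -/
def assocRight {V : Type*} [AddCommGroup V] [Module ℂ V] (mode : ℤ → V →ₗ[ℂ] V →ₗ[ℂ] V)
    (l : ℕ) (p q : ℤ) (u v w : V) : V :=
  ∑ i ∈ Finset.range (l + 1), l.choose i • mode (i - 1 - q) (mode (l - 1 - i - p) u v) w

/-- A nonlocal vertex algebra structure on a complex vector space `V`. The vertex operator map is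
`Y(u, x) v = ∑ₙ (mode n u v) x^(-n-1)`. -/
class NonlocalVertexAlgebra (V : Type*) [AddCommGroup V] [Module ℂ V] where
  /-- `mode n u v` is the `n`-th product `uₙ v`. -/
  mode : ℤ → V →ₗ[ℂ] V →ₗ[ℂ] V
  /-- The vacuum vector. -/
  vac : V
  /-- `Y(u, x) v ∈ V((x))`. -/
  truncation : ∀ u v : V, ∃ N : ℤ, ∀ n, N ≤ n → mode n u v = 0
  /-- `Y(𝟏, x) v = v`. -/
  vac_mode : ∀ (n : ℤ) (v : V), mode n vac v = if n = -1 then v else 0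
  /-- `Y(v, x) 𝟏 ∈ V[[x]]`. -/
  mode_vac_of_nonneg : ∀ (n : ℤ) (v : V), 0 ≤ n → mode n v vac = 0
  /-- The constant term of `Y(v, x) 𝟏` is `v`. -/
  mode_neg_one_vac : ∀ v : V, mode (-1) v vac = v
  /-- `(x₀ + x₂)ˡ Y(u, x₀ + x₂) Y(v, x₂) w = (x₀ + x₂)ˡ Y(Y(u, x₀) v, x₂) w` for some `l ≥ 0`. -/
  weak_assoc : ∀ u v w : V, ∃ l : ℕ, ∀ p q : ℤ,
    assocLeft mode l p q u v w = assocRight mode l p q u v w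

namespace NonlocalVertexAlgebra

/-- An isomorphism of nonlocal vertex algebras. -/
structure Iso (V W : Type*) [AddCommGroup V] [Module ℂ V] [NonlocalVertexAlgebra V]
    [AddCommGroup W] [Module ℂ W] [NonlocalVertexAlgebra W] extends V ≃ₗ[ℂ] W where
  map_vac : toFun vac = vac
  map_mode : ∀ (n : ℤ) (u v : V), toFun (mode n u v) = mode n (toFun u) (toFun v)

end NonlocalVertexAlgebra

/-! ### Iterated Laurent series -/

/-- Exponents `m` of monomials `x₁^(m 0) ⋯ xₙ^(m (n - 1))`, with the lexicographic order for which
the exponent of the last variable `xₙ` is the most significant one. -/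
abbrev Exponent (n : ℕ) : Type := Lex ((Fin n)ᵒᵈ → ℤ)

/-- The exponent attached to an `n`-tuple of integers. -/
def Exponent.mk {n : ℕ} (m : Fin n → ℤ) : Exponent n := toLex fun i => m (OrderDual.ofDual i)

/-- The `n`-tuple of integers attached to an exponent. -/
def Exponent.get {n : ℕ} (m : Exponent n) (i : Fin n) : ℤ := ofLex m (OrderDual.toDual i)

theorem Exponent.get_mk {n : ℕ} (m : Fin n → ℤ) : (Exponent.mk m).get = m := rfl

theorem Exponent.mk_get {n : ℕ} (m : Exponent n) : Exponent.mk m.get = m := rfl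

theorem Exponent.lt_iff {n : ℕ} {a b : Exponent n} :
    a < b ↔ ∃ i, (∀ j, i < j → a.get j = b.get j) ∧ a.get i < b.get i := Iff.rfl

theorem Exponent.mk_snoc_lt {n : ℕ} {a b : Fin n → ℤ} {k : ℤ}
    (h : Exponent.mk a < Exponent.mk b) :
    Exponent.mk (Fin.snoc a k : Fin (n + 1) → ℤ) < Exponent.mk (Fin.snoc b k) := by
  rw [Exponent.lt_iff] at h ⊢
  obtain ⟨i, h1, h2⟩ := h
  refine ⟨i.castSucc, fun j hj => ?_, by simpa [Exponent.get_mk] using h2⟩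
  induction j using Fin.lastCases with
  | last => simp [Exponent.get_mk]
  | cast j => simpa [Exponent.get_mk] using h1 j (by simpa using hj)

theorem Exponent.mk_snoc_lt_of_lt {n : ℕ} {a b : Fin n → ℤ} {k l : ℤ} (h : k < l) :
    Exponent.mk (Fin.snoc a k : Fin (n + 1) → ℤ) < Exponent.mk (Fin.snoc b l) := by
  rw [Exponent.lt_iff]
  refine ⟨Fin.last n, fun j hj => absurd hj (by simpa using Fin.le_last j), ?_⟩
  simpa [Exponent.get_mk] using h

/-- A set of exponents in `n + 1` variables is partially well-ordered if and only if the exponents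
of the last variable are bounded below, and for each exponent of the last variable, the set of the
remaining exponents is partially well-ordered. By induction, `HahnSeries (Exponent n) A` consists
of exactly the formal series in `A((x₁))((x₂))⋯((xₙ))`. -/
theorem Exponent.isPWO_iff {n : ℕ} (S : Set (Exponent (n + 1))) :
    S.IsPWO ↔ (∃ N : ℤ, ∀ m ∈ S, N ≤ m.get (Fin.last n)) ∧
      ∀ k : ℤ, {m : Exponent n | Exponent.mk (Fin.snoc m.get k) ∈ S}.IsPWO := by
  constructor
  · intro h
    constructor
    · have hm : Monotone fun m : Exponent (n + 1) => m.get (Fin.last n) := by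
        intro a b hab
        rcases hab.lt_or_eq with hab | rfl
        · obtain ⟨i, h1, h2⟩ := Exponent.lt_iff.1 hab
          rcases (Fin.le_last i).lt_or_eq with hi | rfl
          · exact (h1 _ hi).le
          · exact h2.le
        · exact le_rfl
      have h2 := (h.image_of_monotone hm).isWF
      rcases S.eq_empty_or_nonempty with rfl | hS
      · exact ⟨0, by simp⟩
      · exact ⟨h2.min (hS.image _), fun m hmS => h2.min_le _ (Set.mem_image_of_mem _ hmS)⟩
    · intro k
      rw [Set.isPWO_iff_isWF, Set.isWF_iff_no_descending_seq]
      intro f hf hmem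
      rw [Set.isPWO_iff_isWF, Set.isWF_iff_no_descending_seq] at h
      refine h (fun i => Exponent.mk (Fin.snoc (f i).get k)) (fun i j hij => ?_) hmem
      exact Exponent.mk_snoc_lt (hf hij)
  · rintro ⟨⟨N, hN⟩, h⟩
    rw [Set.isPWO_iff_isWF]
    rw [Set.isWF_iff_no_descending_seq]
    intro f hf hmem
    have hanti : Antitone fun i => (f i).get (Fin.last n) := by
      refine antitone_nat_of_succ_le fun i => ?_
      obtain ⟨a, h1, h2⟩ := Exponent.lt_iff.1 (hf (Nat.lt_succ_self i))
      rcases (Fin.le_last a).lt_or_eq with ha | rfl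
      · exact (h1 _ ha).le
      · exact h2.le
    obtain ⟨i₀, hi₀⟩ : ∃ i₀, ∀ i, i₀ ≤ i →
        (f i).get (Fin.last n) = (f i₀).get (Fin.last n) := by
      have hne : (Set.range fun i => ((f i).get (Fin.last n) - N).toNat).Nonempty := ⟨_, 0, rfl⟩
      obtain ⟨i₀, hi₀⟩ := Nat.sInf_mem hne
      refine ⟨i₀, fun i hi => ?_⟩
      have h1 : ((f i₀).get (Fin.last n) - N).toNat ≤ ((f i).get (Fin.last n) - N).toNat := by
        refine hi₀.trans_le (Nat.sInf_le ⟨i, rfl⟩)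
      have h2 := hanti hi
      have h3 := hN _ (hmem i)
      simp only at h2
      omega
    have hk := h ((f i₀).get (Fin.last n))
    have hsnoc : ∀ i, i₀ ≤ i → Exponent.mk (Fin.snoc (fun j : Fin n => (f i).get j.castSucc)
        ((f i₀).get (Fin.last n)) : Fin (n + 1) → ℤ) = f i := by
      intro i hi
      rw [← hi₀ i hi]
      conv_rhs => rw [← Exponent.mk_get (f i), ← Fin.snoc_init_self (f i).get]
      rfl
    rw [Set.isPWO_iff_isWF, Set.isWF_iff_no_descending_seq] at hk
    refine hk (fun i => Exponent.mk fun j => (f (i₀ + i)).get j.castSucc) (fun i j hij => ?_)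
      fun i => ?_
    · by_contra hlt
      rcases (not_lt.1 hlt).lt_or_eq with hlt | heq
      · have := Exponent.mk_snoc_lt (k := (f i₀).get (Fin.last n)) hlt
        rw [hsnoc _ (by omega), hsnoc _ (by omega)] at this
        exact lt_asymm this (hf (show i₀ + i < i₀ + j by omega))
      · have := congrArg (fun m : Exponent n => Exponent.mk
          (Fin.snoc m.get ((f i₀).get (Fin.last n)) : Fin (n + 1) → ℤ)) heq
        simp only [Exponent.get_mk] at this
        rw [hsnoc _ (by omega), hsnoc _ (by omega)] at this
        exact (hf (show i₀ + i < i₀ + j by omega)).ne' this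
    · rw [Set.mem_ofPred_eq, Exponent.get_mk, hsnoc _ (by omega)]
      exact hmem _

namespace NonlocalVertexAlgebra

variable {V : Type*} [AddCommGroup V] [Module ℂ V] [NonlocalVertexAlgebra V]

variable (V) in
/-- The coefficient of `x₁^(m 0) ⋯ xₙ^(m (n - 1))` in `Y(u₁, x₁) ⋯ Y(uₙ, xₙ)`, that is, the
composite of the operators `(uᵢ)_{-mᵢ-1}`, as a multilinear function of `u₁, …, uₙ`. -/
def opCoeff {n : ℕ} (m : Fin n → ℤ) :
    MultilinearMap ℂ (fun _ : Fin n => V) (Module.End ℂ V) :=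
  (MultilinearMap.mkPiAlgebraFin ℂ n (Module.End ℂ V)).compLinearMap fun i => mode (-m i - 1)

theorem opCoeff_apply {n : ℕ} (m : Fin n → ℤ) (u : Fin n → V) :
    opCoeff V m u = (List.ofFn fun i => (mode (-m i - 1) (u i) : Module.End ℂ V)).prod := by
  simp [opCoeff, MultilinearMap.mkPiAlgebraFin_apply]

theorem isPWO_opCoeff {n : ℕ} (u : Fin n → V) (w : V) :
    {m : Exponent n | opCoeff V m.get u w ≠ 0}.IsPWO := by
  induction n generalizing w with
  | zero =>
    have : Subsingleton (Exponent 0) := ⟨fun a b => funext fun i => i.ofDual.elim0⟩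
    exact Set.Finite.isPWO Set.subsingleton_of_subsingleton.finite
  | succ n ih =>
    have key : ∀ m : Fin (n + 1) → ℤ, opCoeff V m u w =
        opCoeff V (fun i : Fin n => m i.castSucc) (fun i => u i.castSucc)
          (mode (-m (Fin.last n) - 1) (u (Fin.last n)) w) := by
      intro m
      rw [opCoeff_apply, opCoeff_apply, List.ofFn_succ', List.concat_eq_append, List.prod_append,
        List.prod_singleton, Module.End.mul_apply]
    rw [Exponent.isPWO_iff]
    constructor
    · obtain ⟨N, hN⟩ := truncation (u (Fin.last n)) w
      refine ⟨-N, fun m hm => ?_⟩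
      by_contra hlt
      apply hm
      rw [key, hN _ (by omega), map_zero]
    · intro k
      convert ih (fun i => u i.castSucc) (mode (-k - 1) (u (Fin.last n)) w) using 3 with m
      rw [Set.mem_ofPred_eq, Exponent.get_mk, key]
      simp

/-- The series `Y(u₁, x₁) ⋯ Y(uₙ, xₙ) 𝟏` in `V((x₁))⋯((xₙ))`, as a multilinear function of
`u₁, …, uₙ`. -/
def vacuumSeries (V : Type*) [AddCommGroup V] [Module ℂ V] [NonlocalVertexAlgebra V] (n : ℕ) :
    MultilinearMap ℂ (fun _ : Fin n => V) (HahnModule (Exponent n) ℂ V) where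
  toFun u := HahnModule.of ℂ
    { coeff := fun m => opCoeff V m.get u vac
      isPWO_support' := isPWO_opCoeff u vac }
  map_update_add' u i x y := by
    ext m
    exact congrArg (fun f : Module.End ℂ V => f vac) ((opCoeff V m.get).map_update_add u i x y)
  map_update_smul' u i c x := by
    ext m
    exact congrArg (fun f : Module.End ℂ V => f vac) ((opCoeff V m.get).map_update_smul u i c x)

/-- The linear map `Zₙ : V^{⊗n} ⊗ ℂ((x₁))⋯((xₙ)) → V((x₁))⋯((xₙ))` sending
`u₁ ⊗ ⋯ ⊗ uₙ ⊗ f` to `f Y(u₁, x₁) ⋯ Y(uₙ, xₙ) 𝟏`. -/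
def zMap (V : Type*) [AddCommGroup V] [Module ℂ V] [NonlocalVertexAlgebra V] (n : ℕ) :
    (⨂[ℂ] _ : Fin n, V) ⊗[ℂ] HahnSeries (Exponent n) ℂ →ₗ[ℂ] HahnModule (Exponent n) ℂ V :=
  TensorProduct.lift <| LinearMap.mk₂ ℂ
    (fun t f => f • PiTensorProduct.lift (vacuumSeries V n) t)
    (fun t t' f => by rw [map_add, smul_add])
    (fun c t f => by
      have h : ∀ y : HahnModule (Exponent n) ℂ V,
          c • y = (HahnSeries.single (0 : Exponent n) c) • y := fun y =>
        (HahnModule.single_zero_smul_eq_smul (Exponent n)).symm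
      rw [map_smul, h, h]
      exact (smul_smul f _ _).trans ((congrArg (· • _) (mul_comm f _)).trans (smul_smul _ f _).symm))
    (fun t f f' => by rw [add_smul])
    (fun c t f => by rw [smul_assoc])

theorem zMap_tprod_tmul {n : ℕ} (u : Fin n → V) (f : HahnSeries (Exponent n) ℂ) :
    zMap V n (PiTensorProduct.tprod ℂ u ⊗ₜ[ℂ] f) = f • vacuumSeries V n u := by
  simp [zMap]

/-- `V` is nondegenerate if `Zₙ` is injective for every positive integer `n`. -/
def Nondegenerate (V : Type*) [AddCommGroup V] [Module ℂ V] [NonlocalVertexAlgebra V] : Prop :=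
  ∀ n : ℕ, 0 < n → Function.Injective (zMap V n)

end NonlocalVertexAlgebra

/-! ### Weak associativity is stable under sums -/

theorem sum_choose_smul_succ {V : Type*} [AddCommGroup V] (n : ℕ) (F : ℕ → V) :
    ∑ i ∈ Finset.range (n + 1), n.choose i • F i =
      ∑ i ∈ Finset.range (n + 1), n.choose (i + 1) • F (i + 1) + F 0 := by
  rw [Finset.sum_range_succ', Finset.sum_range_succ _ n, Nat.choose_succ_self, zero_smul, add_zero,
    Nat.choose_zero_right, one_smul]

section Assoc

variable {V : Type*} [AddCommGroup V] [Module ℂ V] {mode : ℤ → V →ₗ[ℂ] V →ₗ[ℂ] V}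

theorem assocLeft_eq_sum {N : ℤ} {v w : V} (hN : ∀ n, N ≤ n → mode n v w = 0) (l : ℕ) (p q : ℤ)
    (u : V) {M : ℕ} (hM : N + 1 + q ≤ M) :
    assocLeft mode l p q u v w =
      ∑ j ∈ Finset.range M, Ring.choose (p + j) j • mode (l - 1 - j - p) u (mode (j - 1 - q) v w) := by
  refine finsum_eq_sum_of_support_subset _ fun j hj => ?_
  by_contra hlt
  rw [Finset.mem_coe, Finset.mem_range, not_lt] at hlt
  exact hj (by simp only [hN (j - 1 - q) (by omega), map_zero, smul_zero])

theorem assoc_mono {N : ℤ} {u v w : V} (hN : ∀ n, N ≤ n → mode n v w = 0) {l l' : ℕ} (hl : l ≤ l')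
    (h : ∀ p q : ℤ, assocLeft mode l p q u v w = assocRight mode l p q u v w) (p q : ℤ) :
    assocLeft mode l' p q u v w = assocRight mode l' p q u v w := by
  induction l', hl using Nat.le_induction generalizing p q with
  | base => exact h p q
  | succ l' _ ih =>
    have hL : assocLeft mode (l' + 1) p q u v w =
        assocLeft mode l' (p - 1) q u v w + assocLeft mode l' p (q - 1) u v w := by
      obtain ⟨M, hM⟩ : ∃ M : ℕ, N + 1 + q ≤ M := ⟨_, Int.self_le_toNat _⟩
      rw [assocLeft_eq_sum hN _ _ _ _ (M := M + 1) (by push_cast; omega),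
        assocLeft_eq_sum hN _ _ _ _ (M := M + 1) (by push_cast; omega),
        assocLeft_eq_sum hN _ _ _ _ (M := M) (by omega),
        Finset.sum_range_succ', Finset.sum_range_succ', add_right_comm, ← Finset.sum_add_distrib]
      congr 1
      · refine Finset.sum_congr rfl fun j _ => ?_
        have h1 : p + ((j + 1 : ℕ) : ℤ) = (p + j) + 1 := by push_cast; ring
        have h2 : p - 1 + ((j + 1 : ℕ) : ℤ) = p + j := by push_cast; ring
        have h3 : ((l' + 1 : ℕ) : ℤ) - 1 - ((j + 1 : ℕ) : ℤ) - p = l' - 1 - j - p := by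
          push_cast; ring
        have h4 : (l' : ℤ) - 1 - ((j + 1 : ℕ) : ℤ) - (p - 1) = l' - 1 - j - p := by
          push_cast; ring
        have h5 : ((j + 1 : ℕ) : ℤ) - 1 - q = j - 1 - (q - 1) := by push_cast; ring
        rw [h1, h2, h3, h4, h5, Ring.choose_succ_succ, add_smul, add_comm]
      · have h3 : ((l' + 1 : ℕ) : ℤ) - 1 - ((0 : ℕ) : ℤ) - p = l' - 1 - ((0 : ℕ) : ℤ) - (p - 1) := by
          push_cast; ring
        rw [h3, Ring.choose_zero_right, Ring.choose_zero_right]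
    have hR : assocRight mode (l' + 1) p q u v w =
        assocRight mode l' (p - 1) q u v w + assocRight mode l' p (q - 1) u v w := by
      unfold assocRight
      rw [Finset.sum_range_succ', sum_choose_smul_succ l' fun i : ℕ =>
        mode (i - 1 - q) (mode (l' - 1 - i - (p - 1)) u v) w, add_right_comm,
        ← Finset.sum_add_distrib]
      congr 1
      · refine Finset.sum_congr rfl fun j _ => ?_
        have h3 : ((l' + 1 : ℕ) : ℤ) - 1 - ((j + 1 : ℕ) : ℤ) - p = l' - 1 - j - p := by
          push_cast; ring
        have h4 : (l' : ℤ) - 1 - ((j + 1 : ℕ) : ℤ) - (p - 1) = l' - 1 - j - p := by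
          push_cast; ring
        have h5 : ((j + 1 : ℕ) : ℤ) - 1 - q = j - 1 - (q - 1) := by push_cast; ring
        rw [h3, h4, h5, Nat.choose_succ_succ, add_smul, add_comm]
      · have h3 : ((l' + 1 : ℕ) : ℤ) - 1 - ((0 : ℕ) : ℤ) - p = l' - 1 - ((0 : ℕ) : ℤ) - (p - 1) := by
          push_cast; ring
        rw [h3, Nat.choose_zero_right, one_smul]
    rw [hL, hR, ih, ih]

variable (mode) in
/-- Weak associativity for the triple `u, v, w`. -/
def WeakAssoc (u v w : V) : Prop :=
  ∃ l : ℕ, ∀ p q : ℤ, assocLeft mode l p q u v w = assocRight mode l p q u v w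

theorem weakAssoc_aux {u₁ u₂ u₃ v₁ v₂ v₃ w₁ w₂ w₃ : V}
    (htr : ∀ u v : V, ∃ N : ℤ, ∀ n, N ≤ n → mode n u v = 0)
    (h : ∀ m n : ℤ, mode m u₃ (mode n v₃ w₃) = mode m u₁ (mode n v₁ w₁) + mode m u₂ (mode n v₂ w₂))
    (h' : ∀ m n : ℤ, mode m (mode n u₃ v₃) w₃ = mode m (mode n u₁ v₁) w₁ + mode m (mode n u₂ v₂) w₂)
    (h₁ : WeakAssoc mode u₁ v₁ w₁) (h₂ : WeakAssoc mode u₂ v₂ w₂) : WeakAssoc mode u₃ v₃ w₃ := by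
  obtain ⟨l₁, h₁⟩ := h₁
  obtain ⟨l₂, h₂⟩ := h₂
  obtain ⟨N₁, hN₁⟩ := htr v₁ w₁
  obtain ⟨N₂, hN₂⟩ := htr v₂ w₂
  obtain ⟨N₃, hN₃⟩ := htr v₃ w₃
  refine ⟨max l₁ l₂, fun p q => ?_⟩
  have e₁ := assoc_mono hN₁ (le_max_left l₁ l₂) h₁ p q
  have e₂ := assoc_mono hN₂ (le_max_right l₁ l₂) h₂ p q
  obtain ⟨M, hM⟩ : ∃ M : ℕ, max N₁ (max N₂ N₃) + 1 + q ≤ M := ⟨_, Int.self_le_toNat _⟩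
  rw [assocLeft_eq_sum hN₁ _ _ _ _ (M := M) (by omega)] at e₁
  rw [assocLeft_eq_sum hN₂ _ _ _ _ (M := M) (by omega)] at e₂
  rw [assocLeft_eq_sum hN₃ _ _ _ _ (M := M) (by omega)]
  simp only [assocRight, h, h', smul_add, Finset.sum_add_distrib] at e₁ e₂ ⊢
  rw [e₁, e₂]

end Assoc

/-! ### Filtrations and associated graded nonlocal vertex algebras -/

open NonlocalVertexAlgebra

/-- An increasing (exhaustive) filtration `E` of a nonlocal vertex algebra by subspaces indexed by
the integers, with `𝟏 ∈ E₀` and `uₖ v ∈ E_{m+n}` for `u ∈ E_m`, `v ∈ E_n` and all integers `k`. -/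
structure VertexFiltration (V : Type*) [AddCommGroup V] [Module ℂ V] [NonlocalVertexAlgebra V] where
  /-- The subspace `E n`. -/
  space : ℤ → Submodule ℂ V
  mono : Monotone space
  exhaustive : ∀ v : V, ∃ n, v ∈ space n
  vac_mem : vac ∈ space 0
  mode_mem : ∀ {m n : ℤ} (k : ℤ) {u v : V}, u ∈ space m → v ∈ space n → mode k u v ∈ space (m + n)

namespace VertexFiltration

variable {V : Type*} [AddCommGroup V] [Module ℂ V] [NonlocalVertexAlgebra V]

/-- The quotient `E n / E (n - 1)`. -/
def Piece (E : VertexFiltration V) (n : ℤ) : Type _ :=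
  E.space n ⧸ (E.space (n - 1)).submoduleOf (E.space n)

instance (E : VertexFiltration V) (n : ℤ) : AddCommGroup (E.Piece n) :=
  inferInstanceAs (AddCommGroup (_ ⧸ _))

instance (E : VertexFiltration V) (n : ℤ) : Module ℂ (E.Piece n) :=
  inferInstanceAs (Module ℂ (E.space n ⧸ (E.space (n - 1)).submoduleOf (E.space n)))

/-- The associated graded vector space `⨁ₙ E n / E (n - 1)`. -/
abbrev Gr (E : VertexFiltration V) : Type _ := DirectSum ℤ E.Piece

variable (E : VertexFiltration V)

/-- The quotient map `E n → E n / E (n - 1)`. -/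
def mkPiece (n : ℤ) : E.space n →ₗ[ℂ] E.Piece n :=
  Submodule.mkQ ((E.space (n - 1)).submoduleOf (E.space n))

theorem mkPiece_surjective (n : ℤ) : Function.Surjective (E.mkPiece n) :=
  Submodule.mkQ_surjective _

theorem mkPiece_eq_zero {n : ℤ} (v : E.space n) : E.mkPiece n v = 0 ↔ (v : V) ∈ E.space (n - 1) :=
  Submodule.Quotient.mk_eq_zero _

/-- The linear map on `E n / E (n - 1)` induced by a linear map on `E n`. -/
def liftPiece {X : Type*} [AddCommGroup X] [Module ℂ X] {n : ℤ} (f : E.space n →ₗ[ℂ] X)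
    (h : ∀ v : E.space n, (v : V) ∈ E.space (n - 1) → f v = 0) : E.Piece n →ₗ[ℂ] X :=
  Submodule.liftQ ((E.space (n - 1)).submoduleOf (E.space n)) f h

theorem liftPiece_mkPiece {X : Type*} [AddCommGroup X] [Module ℂ X] {n : ℤ}
    (f : E.space n →ₗ[ℂ] X) (h : ∀ v : E.space n, (v : V) ∈ E.space (n - 1) → f v = 0)
    (v : E.space n) : E.liftPiece f h (E.mkPiece n v) = f v := rfl

/-- The map `E n → gr` sending `v` to `v + E (n - 1)` in degree `n`. -/
def cls (n : ℤ) : E.space n →ₗ[ℂ] E.Gr :=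
  DirectSum.lof ℂ ℤ E.Piece n ∘ₗ E.mkPiece n

theorem cls_eq_zero {n : ℤ} {v : V} (hv : v ∈ E.space n) (h : v ∈ E.space (n - 1)) :
    E.cls n ⟨v, hv⟩ = 0 := by
  rw [cls, LinearMap.comp_apply, (E.mkPiece_eq_zero _).2 h, map_zero]

theorem cls_congr {m n : ℤ} {v : V} (hv : v ∈ E.space m) (h : m = n) :
    E.cls m ⟨v, hv⟩ = E.cls n ⟨v, h ▸ hv⟩ := by
  subst h; rfl

theorem cls_zsmul {n : ℤ} (c : ℤ) (v : E.space n) : E.cls n (c • v) = c • E.cls n v :=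
  map_zsmul (E.cls n) c v

/-- The `k`-th product `E m × E n → gr`, `(u, v) ↦ uₖ v + E (m + n - 1)`. -/
def modeAux (k m n : ℤ) : E.space m →ₗ[ℂ] E.space n →ₗ[ℂ] E.Gr :=
  LinearMap.mk₂ ℂ (fun u v => E.cls (m + n) ⟨mode k u.1 v.1, E.mode_mem k u.2 v.2⟩)
    (fun u u' v => by
      rw [← map_add]; congr 1; ext; simp)
    (fun c u v => by
      rw [← map_smul]; congr 1; ext; simp)
    (fun u v v' => by
      rw [← map_add]; congr 1; ext; simp)
    (fun c u v => by
      rw [← map_smul]; congr 1; ext; simp)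

theorem modeAux_apply (k m n : ℤ) (u : E.space m) (v : E.space n) :
    E.modeAux k m n u v = E.cls (m + n) ⟨mode k u.1 v.1, E.mode_mem k u.2 v.2⟩ := rfl

/-- The `k`-th product `E m × E n / E (n - 1) → gr`. -/
def modeRight (k m n : ℤ) : E.space m →ₗ[ℂ] E.Piece n →ₗ[ℂ] E.Gr where
  toFun u := E.liftPiece (E.modeAux k m n u) fun v hv => by
    rw [modeAux_apply]
    refine E.cls_eq_zero _ ?_
    rw [add_sub_assoc]
    exact E.mode_mem k u.2 hv
  map_add' u u' := by
    refine LinearMap.ext fun x => ?_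
    obtain ⟨v, rfl⟩ := E.mkPiece_surjective _ x
    simp [liftPiece_mkPiece]
  map_smul' c u := by
    refine LinearMap.ext fun x => ?_
    obtain ⟨v, rfl⟩ := E.mkPiece_surjective _ x
    simp [liftPiece_mkPiece]

/-- The `k`-th product `E m / E (m - 1) × E n / E (n - 1) → gr`. -/
def modePiece (k m n : ℤ) : E.Piece m →ₗ[ℂ] E.Piece n →ₗ[ℂ] E.Gr :=
  E.liftPiece (E.modeRight k m n) fun u hu => by
    refine LinearMap.ext fun x => ?_
    obtain ⟨v, rfl⟩ := E.mkPiece_surjective _ x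
    change E.modeAux k m n u v = 0
    rw [modeAux_apply]
    refine E.cls_eq_zero _ ?_
    rw [add_sub_right_comm]
    exact E.mode_mem k hu v.2

/-- The `k`-th product on `gr`: `(u + E (m - 1))ₖ (v + E (n - 1)) = uₖ v + E (m + n - 1)`. -/
def grMode (k : ℤ) : E.Gr →ₗ[ℂ] E.Gr →ₗ[ℂ] E.Gr :=
  DirectSum.toModule ℂ ℤ _ fun m =>
    (DirectSum.toModule ℂ ℤ _ fun n => (E.modePiece k m n).flip).flip

theorem grMode_cls (k : ℤ) {m n : ℤ} (u : E.space m) (v : E.space n) :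
    E.grMode k (E.cls m u) (E.cls n v) =
      E.cls (m + n) ⟨mode k u.1 v.1, E.mode_mem k u.2 v.2⟩ := by
  rw [← modeAux_apply]
  simp [grMode, cls, modePiece, modeRight, liftPiece_mkPiece]

theorem gr_induction {P : E.Gr → Prop} (zero : P 0)
    (cls : ∀ n (v : V) (hv : v ∈ E.space n), P (E.cls n ⟨v, hv⟩))
    (add : ∀ x y, P x → P y → P (x + y)) (x : E.Gr) : P x := by
  induction x using DirectSum.induction_on with
  | zero => exact zero
  | of n x =>
    obtain ⟨⟨v, hv⟩, rfl⟩ := E.mkPiece_surjective _ x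
    exact cls n v hv
  | add x y hx hy => exact add x y hx hy

theorem grMode_truncation (x y : E.Gr) : ∃ N : ℤ, ∀ n, N ≤ n → E.grMode n x y = 0 := by
  induction x using E.gr_induction with
  | zero => exact ⟨0, by simp⟩
  | add x x' h h' =>
    obtain ⟨N, hN⟩ := h
    obtain ⟨N', hN'⟩ := h'
    exact ⟨max N N', fun n hn => by
      rw [map_add, LinearMap.add_apply, hN n (by omega), hN' n (by omega), add_zero]⟩
  | cls m u hu =>
    induction y using E.gr_induction with
    | zero => exact ⟨0, by simp⟩
    | add x x' h h' =>
      obtain ⟨N, hN⟩ := h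
      obtain ⟨N', hN'⟩ := h'
      exact ⟨max N N', fun n hn => by
        rw [map_add, hN n (by omega), hN' n (by omega), add_zero]⟩
    | cls n v hv =>
      obtain ⟨N, hN⟩ := truncation u v
      refine ⟨N, fun k hk => ?_⟩
      rw [grMode_cls]
      exact E.cls_eq_zero _ (by simp [hN k hk])

theorem weakAssoc_cls {m n r : ℤ} (u : E.space m) (v : E.space n) (w : E.space r) :
    WeakAssoc E.grMode (E.cls m u) (E.cls n v) (E.cls r w) := by
  obtain ⟨l, hl⟩ := weak_assoc u.1 v.1 w.1
  obtain ⟨N, hN⟩ := truncation v.1 w.1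
  refine ⟨l, fun p q => ?_⟩
  obtain ⟨M, hM⟩ : ∃ M : ℕ, N + 1 + q ≤ M := ⟨_, Int.self_le_toNat _⟩
  have hN' : ∀ k, N ≤ k → E.grMode k (E.cls n v) (E.cls r w) = 0 := fun k hk => by
    rw [grMode_cls]
    exact E.cls_eq_zero _ (by simp [hN k hk])
  have e := hl p q
  rw [assocLeft_eq_sum hN l p q _ hM] at e
  rw [assocLeft_eq_sum hN' l p q _ hM, assocRight]
  rw [assocRight] at e
  simp only [grMode_cls, E.cls_congr _ (add_assoc m n r)]
  simp only [← cls_zsmul, ← map_nsmul, ← map_sum]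
  congr 1
  ext
  simpa using e

theorem weakAssoc_gr (x y z : E.Gr) : WeakAssoc E.grMode x y z := by
  induction x using E.gr_induction with
  | zero => exact ⟨0, fun p q => by simp [assocLeft, assocRight]⟩
  | add x x' h h' =>
    exact weakAssoc_aux E.grMode_truncation (by simp) (by simp) h h'
  | cls m u hu =>
    induction y using E.gr_induction with
    | zero => exact ⟨0, fun p q => by simp [assocLeft, assocRight]⟩
    | add y y' h h' =>
      exact weakAssoc_aux E.grMode_truncation (by simp) (by simp) h h'
    | cls n v hv =>
      induction z using E.gr_induction with
      | zero => exact ⟨0, fun p q => by simp [assocLeft, assocRight]⟩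
      | add z z' h h' =>
        exact weakAssoc_aux E.grMode_truncation (by simp) (by simp) h h'
      | cls r w hw => exact E.weakAssoc_cls _ _ _

/-- The associated graded nonlocal vertex algebra, with vacuum vector `𝟏 + E (-1)` in degree `0`. -/
instance : NonlocalVertexAlgebra E.Gr where
  mode := E.grMode
  vac := E.cls 0 ⟨vac, E.vac_mem⟩
  truncation := E.grMode_truncation
  vac_mode k x := by
    induction x using E.gr_induction with
    | zero => simp
    | add x y hx hy => rw [map_add, hx, hy]; split_ifs <;> simp
    | cls n v hv =>
      rw [grMode_cls, E.cls_congr _ (zero_add n)]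
      simp only [vac_mode]
      split_ifs
      · rfl
      · exact map_zero _
  mode_vac_of_nonneg k x hk := by
    induction x using E.gr_induction with
    | zero => simp
    | add x y hx hy => rw [map_add, LinearMap.add_apply, hx, hy, add_zero]
    | cls n v hv =>
      rw [grMode_cls]
      exact E.cls_eq_zero _ (by simp [mode_vac_of_nonneg k v hk])
  mode_neg_one_vac x := by
    induction x using E.gr_induction with
    | zero => simp
    | add x y hx hy => rw [map_add, LinearMap.add_apply, hx, hy]
    | cls n v hv =>
      rw [grMode_cls, E.cls_congr _ (add_zero n)]
      simp only [mode_neg_one_vac]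
  weak_assoc := E.weakAssoc_gr

end VertexFiltration

/-! ### The free commutative differential algebra -/

section Derivation

variable {A : Type*} [CommRing A] [Algebra ℂ A] (D : Derivation ℂ A A)

/-- The operator `Dᵏ / k!`. -/
def divPow (k : ℕ) : A →ₗ[ℂ] A := ((k.factorial : ℂ)⁻¹) • (D.toLinearMap ^ k)

theorem divPow_divPow (i k : ℕ) (a : A) :
    divPow D i (divPow D k a) = (k + i).choose i • divPow D (k + i) a := by
  have h : ((k + i).choose i : ℂ) * ((k + i).factorial : ℂ)⁻¹ =
      (i.factorial : ℂ)⁻¹ * (k.factorial : ℂ)⁻¹ := by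
    have h1 : ((k + i).choose i : ℂ) * i.factorial * k.factorial = (k + i).factorial := by
      have := Nat.choose_mul_factorial_mul_factorial (Nat.le_add_left i k)
      rw [Nat.add_sub_cancel] at this
      exact_mod_cast this
    have := Nat.cast_ne_zero (R := ℂ).2 i.factorial_ne_zero
    have := Nat.cast_ne_zero (R := ℂ).2 k.factorial_ne_zero
    have := Nat.cast_ne_zero (R := ℂ).2 (k + i).factorial_ne_zero
    field_simp
    linear_combination h1
  rw [← Nat.cast_smul_eq_nsmul ℂ]
  simp only [divPow, LinearMap.smul_apply, map_smul, smul_smul]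
  rw [h, ← Module.End.mul_apply, ← pow_add, add_comm i k, mul_comm]

theorem pow_apply_mul (k : ℕ) (a b : A) :
    (D.toLinearMap ^ k) (a * b) = ∑ ij ∈ Finset.HasAntidiagonal.antidiagonal k,
      k.choose ij.1 • ((D.toLinearMap ^ ij.1) a * (D.toLinearMap ^ ij.2) b) := by
  induction k with
  | zero => simp
  | succ k ih =>
    rw [Finset.sum_antidiagonal_choose_succ_nsmul
      (fun i j => (D.toLinearMap ^ i) a * (D.toLinearMap ^ j) b) k]
    simp only [pow_succ', Module.End.mul_apply, ih, map_sum, map_nsmul, 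
      Derivation.coeFn_coe, Derivation.leibniz, smul_eq_mul, smul_add, Finset.sum_add_distrib]
    congr 1
    refine Finset.sum_congr rfl fun ij hij => ?_
    rw [k.choose_symm_of_eq_add (Finset.HasAntidiagonal.mem_antidiagonal.1 hij).symm, mul_comm]

theorem divPow_mul (k : ℕ) (a b : A) :
    divPow D k (a * b) = ∑ i ∈ Finset.range (k + 1), divPow D i a * divPow D (k - i) b := by
  rw [← Finset.Nat.sum_antidiagonal_eq_sum_range_succ fun i j => divPow D i a * divPow D j b]
  simp only [divPow, LinearMap.smul_apply]
  rw [pow_apply_mul, Finset.smul_sum]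
  refine Finset.sum_congr rfl fun ij hij => ?_
  rw [← Nat.cast_smul_eq_nsmul ℂ, smul_smul, smul_mul_smul_comm]
  congr 1
  rw [Finset.HasAntidiagonal.mem_antidiagonal] at hij
  subst hij
  have h1 := Nat.choose_mul_factorial_mul_factorial (Nat.le_add_right ij.1 ij.2)
  rw [Nat.add_sub_cancel_left] at h1
  have h1 : ((ij.1 + ij.2).choose ij.1 : ℂ) * ij.1.factorial * ij.2.factorial =
    (ij.1 + ij.2).factorial := by exact_mod_cast h1
  have := Nat.cast_ne_zero (R := ℂ).2 ij.1.factorial_ne_zero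
  have := Nat.cast_ne_zero (R := ℂ).2 ij.2.factorial_ne_zero
  have := Nat.cast_ne_zero (R := ℂ).2 (ij.1 + ij.2).factorial_ne_zero
  field_simp
  linear_combination h1

/-- The products `aₙ b` determined by `Y(a, x) b = (exp(x D) a) b`. -/
def derivationMode (n : ℤ) : A →ₗ[ℂ] A →ₗ[ℂ] A :=
  if n < 0 then LinearMap.mul ℂ A ∘ₗ divPow D (-n - 1).toNat else 0

theorem derivationMode_neg (k : ℕ) (a b : A) :
    derivationMode D (-1 - k) a b = divPow D k a * b := by
  rw [derivationMode, if_pos (by omega), show (-(-1 - (k : ℤ)) - 1).toNat = k by omega]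
  rfl

theorem derivationMode_nonneg {n : ℤ} (hn : 0 ≤ n) (a b : A) : derivationMode D n a b = 0 := by
  rw [derivationMode, if_neg (by omega)]
  rfl

theorem divPow_one (k : ℕ) : divPow D k 1 = if k = 0 then 1 else 0 := by
  cases k with
  | zero => simp [divPow]
  | succ k => simp [divPow, pow_succ]

/-- A commutative associative algebra with a derivation `D`, viewed as a nonlocal vertex algebra
with `𝟏 = 1` and `Y(a, x) b = (exp(x D) a) b`. -/
@[reducible]
def NonlocalVertexAlgebra.ofDerivation : NonlocalVertexAlgebra A where
  mode := derivationMode D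
  vac := 1
  truncation a b := ⟨0, fun n hn => derivationMode_nonneg D hn a b⟩
  vac_mode n a := by
    rcases lt_or_ge n 0 with hn | hn
    · obtain ⟨k, rfl⟩ : ∃ k : ℕ, n = -1 - k := ⟨(-n - 1).toNat, by omega⟩
      rw [derivationMode_neg, divPow_one]
      split_ifs <;> first | omega | simp
    · rw [derivationMode_nonneg D hn, if_neg (by omega)]
  mode_vac_of_nonneg n a hn := derivationMode_nonneg D hn a 1
  mode_neg_one_vac a := by
    have := derivationMode_neg D 0 a 1
    simpa [divPow] using this
  weak_assoc a b c := by
    refine ⟨0, fun p q => ?_⟩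
    have hN : ∀ n : ℤ, 0 ≤ n → derivationMode D n b c = 0 := fun n hn =>
      derivationMode_nonneg D hn b c
    rcases lt_or_ge q 0 with hq | hq
    · rw [assocLeft_eq_sum hN 0 p q a (M := 0) (by push_cast; omega)]
      simp [assocRight, derivationMode_nonneg D (show 0 ≤ -1 - q by omega)]
    obtain ⟨q, rfl⟩ := Int.eq_ofNat_of_zero_le hq
    rw [assocLeft_eq_sum hN 0 p q a (M := q + 1) (by push_cast; omega)]
    simp only [assocRight, zero_add, Finset.sum_range_one, Nat.choose_self, one_smul]
    rcases lt_or_ge p 0 with hp | hp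
    · rw [derivationMode_nonneg D (show 0 ≤ ((0 : ℕ) : ℤ) - 1 - ((0 : ℕ) : ℤ) - p by push_cast; omega),
        map_zero, LinearMap.zero_apply]
      refine Finset.sum_eq_zero fun j _ => ?_
      rcases lt_or_ge (p + j) 0 with h | h
      · rw [derivationMode_nonneg D (show 0 ≤ ((0 : ℕ) : ℤ) - 1 - j - p by push_cast; omega), smul_zero]
      · obtain ⟨r, hr⟩ := Int.eq_ofNat_of_zero_le h
        rw [hr, Ring.choose_natCast, Nat.choose_eq_zero_of_lt (by omega), Nat.cast_zero, zero_smul]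
    · obtain ⟨p, rfl⟩ := Int.eq_ofNat_of_zero_le hp
      rw [show ((0 : ℕ) : ℤ) - 1 - ((0 : ℕ) : ℤ) - p = -1 - p by push_cast; ring,
        show ((0 : ℕ) : ℤ) - 1 - (q : ℤ) = -1 - q by push_cast; ring,
        derivationMode_neg, derivationMode_neg, divPow_mul, Finset.sum_mul]
      refine Finset.sum_congr rfl fun j hj => ?_
      rw [Finset.mem_range] at hj
      rw [show ((0 : ℕ) : ℤ) - 1 - (j : ℤ) - p = -1 - (p + j : ℕ) by push_cast; ring,
        show (j : ℤ) - 1 - q = -1 - (q - j : ℕ) by omega,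
        derivationMode_neg, derivationMode_neg, divPow_divPow, ← Nat.cast_add, Ring.choose_natCast,
        natCast_zsmul, smul_mul_assoc, smul_mul_assoc, mul_assoc]

end Derivation

/-- The symmetric algebra `S(ℂ[∂] ⊗ U)`. -/
abbrev FCD (U : Type*) [AddCommGroup U] [Module ℂ U] : Type _ :=
  SymmetricAlgebra ℂ (Polynomial ℂ ⊗[ℂ] U)

namespace FCD

variable (U : Type*) [AddCommGroup U] [Module ℂ U]

/-- Multiplication by `∂` on `ℂ[∂] ⊗ U`. -/
def shift : Polynomial ℂ ⊗[ℂ] U →ₗ[ℂ] Polynomial ℂ ⊗[ℂ] U :=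
  LinearMap.rTensor U (LinearMap.mulLeft ℂ Polynomial.X)

/-- The algebra map `a ↦ a + ∂(a) ε` to the dual numbers over `S(ℂ[∂] ⊗ U)`. -/
def toDual : FCD U →ₐ[ℂ] TrivSqZeroExt (FCD U) (FCD U) :=
  SymmetricAlgebra.lift
    ((TrivSqZeroExt.inlAlgHom ℂ (FCD U) (FCD U)).toLinearMap ∘ₗ SymmetricAlgebra.ι ℂ _ +
      (TrivSqZeroExt.inrHom (FCD U) (FCD U)).restrictScalars ℂ ∘ₗ
        SymmetricAlgebra.ι ℂ _ ∘ₗ shift U)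

theorem fst_toDual (a : FCD U) : (toDual U a).fst = a := by
  have : (TrivSqZeroExt.fstHom ℂ (FCD U) (FCD U)).comp (toDual U) = AlgHom.id ℂ (FCD U) := by
    apply SymmetricAlgebra.algHom_ext
    apply LinearMap.ext
    intro m
    simp [toDual]
  exact DFunLike.congr_fun this a

/-- The derivation `∂` of `S(ℂ[∂] ⊗ U)` that extends multiplication by `∂` on `ℂ[∂] ⊗ U`. -/
def deriv : Derivation ℂ (FCD U) (FCD U) where
  toFun a := (toDual U a).snd
  map_add' a b := by simp
  map_smul' c a := by simp
  map_one_eq_zero' := by simp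
  leibniz' a b := by
    simp [fst_toDual, mul_comm]

theorem deriv_ι (m : Polynomial ℂ ⊗[ℂ] U) :
    deriv U (SymmetricAlgebra.ι ℂ _ m) = SymmetricAlgebra.ι ℂ _ (shift U m) := by
  change (toDual U _).snd = _
  simp [toDual]

/-- The free commutative differential algebra over `U`, viewed as a nonlocal vertex algebra. -/
instance : NonlocalVertexAlgebra (FCD U) := NonlocalVertexAlgebra.ofDerivation (deriv U)

end FCD

end

noncomputable section

open scoped TensorProduct

open NonlocalVertexAlgebra

/-! ### Coefficientwise linear maps -/

/-! Write K for the field ℂ((x₁))⋯((xₙ)). A basis of V makes the source of Zₙ a free K-module on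
n-tuples of basis vectors, so injectivity of Zₙ means that the series Y(u₁, x₁)⋯Y(uₙ, xₙ)𝟏, for
basis vectors uᵢ, are linearly independent over K (`injective_zMap_iff`).

Part 1 is a leading term argument. Lifting bases of the quotients E n / E (n - 1) gives a basis of
V, because E is exhaustive and lower truncated. The leading term of a series attached to lifted
basis vectors is the series of gr attached to their classes (`symbol_opCoeff`), and independence of
leading terms implies independence (`LinearIndependent.of_symbol`).

Part 2 then reduces to nondegeneracy of FCD(U), which is the algebra of polynomials in X_(k, a),
where a runs through a basis of U and ∂ raises k. There the series is the product of the exp(xᵢ∂)uᵢ.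
For monomials uᵢ these products are the images of distinct monomials in variables X_(i, k, a) under
X_(i, k, a) ↦ exp(xᵢ∂)X_(k, a) = ∑ⱼ xᵢʲ/j! X_(k + j, a), so it suffices that this substitution is
injective over K (`evalTaylor_injective`). A given polynomial involves only k < m. After killing
X_(l, a) with l ≥ nm, the images of these variables are linear forms, independent by Hermite
interpolation at the distinct nodes x₁, …, xₙ of K (`hermite_coeff_eq_zero`). Substituting
independent linear forms is injective. -/

/-- The map of Hahn modules obtained by applying a linear map to all coefficients. -/
def HahnModule.mapCoeff (Γ : Type*) {V W : Type*} [AddCommGroup Γ] [LinearOrder Γ]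
    [IsOrderedCancelAddMonoid Γ] [AddCommGroup V] [Module ℂ V] [AddCommGroup W] [Module ℂ W]
    (φ : V →ₗ[ℂ] W) : HahnModule Γ ℂ V →ₗ[HahnSeries Γ ℂ] HahnModule Γ ℂ W where
  toFun y := HahnModule.of ℂ (((HahnModule.of ℂ).symm y).map φ)
  map_add' x y := by
    ext a
    simp
  map_smul' f y := by
    ext a
    -- `φ` may kill coefficients; both convolution sums are therefore taken over the support of `y`.
    rw [RingHom.id_apply, HahnModule.coeff_smul_right ((HahnModule.of ℂ).symm y).isPWO_support
      (fun m hm hy => hm (by simp [hy]))]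
    simp [HahnModule.coeff_smul]

theorem HahnModule.coeff_mapCoeff {Γ V W : Type*} [AddCommGroup Γ] [LinearOrder Γ]
    [IsOrderedCancelAddMonoid Γ] [AddCommGroup V] [Module ℂ V] [AddCommGroup W] [Module ℂ W]
    (φ : V →ₗ[ℂ] W) (y : HahnModule Γ ℂ V) (a : Γ) :
    ((HahnModule.of ℂ).symm (HahnModule.mapCoeff Γ φ y)).coeff a =
      φ (((HahnModule.of ℂ).symm y).coeff a) := rfl

theorem DFinsupp.basis_apply_single {ι R : Type*} [DecidableEq ι] [Semiring R] {M : ι → Type*}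
    [∀ i, AddCommMonoid (M i)] [∀ i, Module R (M i)] {η : ι → Type*}
    (b : ∀ i, Module.Basis (η i) R (M i)) (i : Σ i, η i) :
    DFinsupp.basis b i = DFinsupp.single i.1 (b i.1 i.2) := by
  have h : sigmaFinsuppLequivDFinsupp R (Finsupp.single i (1 : R)) =
      DFinsupp.single i.1 (Finsupp.single i.2 (1 : R)) := sigmaFinsuppEquivDFinsupp_single i 1
  rw [DFinsupp.basis, Module.Basis.coe_ofRepr, LinearEquiv.symm_apply_eq,
    LinearEquiv.trans_apply, LinearEquiv.eq_symm_apply, h]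
  simp

/-! ### Nondegeneracy as linear independence -/

namespace NonlocalVertexAlgebra

variable {V : Type*} [AddCommGroup V] [Module ℂ V] [NonlocalVertexAlgebra V]

theorem coeff_vacuumSeries {n : ℕ} (u : Fin n → V) (m : Exponent n) :
    ((HahnModule.of ℂ).symm (vacuumSeries V n u)).coeff m = opCoeff V m.get u vac := rfl

open scoped Classical in
theorem zMap_equivFinsupp_symm {n : ℕ} {ι : Type*} (b : Module.Basis ι ℂ V)
    (f : (Fin n → ι) →₀ HahnSeries (Exponent n) ℂ) :
    zMap V n ((TensorProduct.equivFinsuppOfBasisLeft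
        (Basis.piTensorProduct fun _ : Fin n => b)).symm f) =
      Finsupp.linearCombination (HahnSeries (Exponent n) ℂ)
        (fun I : Fin n → ι => vacuumSeries V n (b ∘ I)) f := by
  rw [TensorProduct.equivFinsuppOfBasisLeft_symm_apply, Finsupp.linearCombination_apply,
    Finsupp.sum, Finsupp.sum, map_sum]
  refine Finset.sum_congr rfl fun I _ => ?_
  rw [Basis.piTensorProduct_apply, zMap_tprod_tmul]
  rfl

/-- In the tensor basis indexed by n-tuples, `zMap` becomes the linear combination map over the ring
of series. The basis is arbitrary, so it can be adapted to a filtration or consist of monomials. -/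
theorem injective_zMap_iff {n : ℕ} {ι : Type*} (b : Module.Basis ι ℂ V) :
    Function.Injective (zMap V n) ↔ LinearIndependent (HahnSeries (Exponent n) ℂ)
      fun I : Fin n → ι => vacuumSeries V n (b ∘ I) := by
  classical
  rw [LinearIndependent, ← EquivLike.injective_comp
    (TensorProduct.equivFinsuppOfBasisLeft (N := HahnSeries (Exponent n) ℂ)
      (Basis.piTensorProduct fun _ : Fin n => b)).symm]
  exact iff_of_eq (congrArg _ (funext fun f => zMap_equivFinsupp_symm b f))

/-! ### Isomorphisms -/

theorem Iso.map_opCoeff {W : Type*} [AddCommGroup W] [Module ℂ W] [NonlocalVertexAlgebra W]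
    (e : Iso V W) {n : ℕ} (m : Fin n → ℤ) (u : Fin n → V) (w : V) :
    e.toLinearEquiv (opCoeff V m u w) =
      opCoeff W m (fun i => e.toLinearEquiv (u i)) (e.toLinearEquiv w) := by
  simp only [opCoeff_apply]
  induction n with
  | zero => simp
  | succ n ih =>
    rw [List.ofFn_succ, List.ofFn_succ, List.prod_cons, List.prod_cons, Module.End.mul_apply,
      Module.End.mul_apply, ← ih]
    exact e.map_mode _ _ _

theorem Nondegenerate.of_iso {W : Type*} [AddCommGroup W] [Module ℂ W] [NonlocalVertexAlgebra W]
    (e : Iso V W) (h : Nondegenerate W) : Nondegenerate V := by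
  intro n hn
  let b := Module.Basis.ofVectorSpace ℂ V
  rw [injective_zMap_iff b]
  have h1 := (injective_zMap_iff (b.map e.toLinearEquiv)).1 (h n hn)
  refine LinearIndependent.of_comp
    (HahnModule.mapCoeff (Exponent n) e.toLinearEquiv.toLinearMap) ?_
  convert h1 using 1
  funext I
  ext m
  rw [Function.comp_apply, HahnModule.coeff_mapCoeff, coeff_vacuumSeries, coeff_vacuumSeries]
  refine (e.map_opCoeff _ _ _).trans ?_
  exact congrArg _ e.map_vac

end NonlocalVertexAlgebra

/-! ### Symbols -/

/-- A family is linearly independent if the leading terms of its members are. -/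
theorem LinearIndependent.of_symbol {R M N ι : Type*} [Ring R] [AddCommGroup M] [Module R M]
    [AddCommGroup N] [Module R N] {v : ι → M} {w : ι → N} (d : ι → ℤ) (σ : ℤ → M →ₗ[R] N)
    (heq : ∀ i, σ (d i) (v i) = w i) (hlt : ∀ i k, d i < k → σ k (v i) = 0)
    (hw : LinearIndependent R w) : LinearIndependent R v := by
  classical
  rw [linearIndependent_iff'] at hw ⊢
  intro s g hg
  by_contra! hne
  have hs : (s.filter fun i => g i ≠ 0).Nonempty := by
    obtain ⟨i, hi, h⟩ := hne
    exact ⟨i, by simp [hi, h]⟩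
  -- Applying `σ (d i₀)`, for the top degree among nonzero coefficients, kills the terms of lower
  -- degree and leaves a relation among the `w i` of degree `d i₀`.
  obtain ⟨i₀, hi₀, hmax⟩ := Finset.exists_max_image _ d hs
  rw [Finset.mem_filter] at hi₀
  refine hi₀.2 (hw (s.filter fun i => d i = d i₀) g ?_ i₀ (by simp [hi₀.1]))
  refine Eq.trans ?_ ((congrArg (σ (d i₀)) hg).trans (map_zero _))
  rw [Finset.sum_filter, map_sum]
  refine Finset.sum_congr rfl fun i hi => ?_
  rw [map_smul]
  split_ifs with h
  · rw [← h, heq]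
  · by_cases hgi : g i = 0
    · rw [hgi, zero_smul]
    · rw [hlt _ _ (lt_of_le_of_ne (hmax i (by simp [hi, hgi])) h), smul_zero]

namespace VertexFiltration

variable {V : Type*} [AddCommGroup V] [Module ℂ V] [NonlocalVertexAlgebra V]
  (E : VertexFiltration V)

/-- A linear map on a subspace extends to the whole space. The values outside `E n` are arbitrary
and play no role; a domain equal to all of V allows coefficientwise application to V-valued series.
-/
theorem exists_symbol (n : ℤ) : ∃ σ : V →ₗ[ℂ] E.Gr, ∀ v (hv : v ∈ E.space n),
    σ v = E.cls n ⟨v, hv⟩ := by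
  obtain ⟨σ, h⟩ := LinearMap.exists_extend (E.cls n)
  exact ⟨σ, fun v hv => LinearMap.congr_fun h ⟨v, hv⟩⟩

/-- A linear extension to `V` of the map `E n → gr`. -/
def symbol (n : ℤ) : V →ₗ[ℂ] E.Gr := (E.exists_symbol n).choose

theorem symbol_apply {n : ℤ} {v : V} (hv : v ∈ E.space n) : E.symbol n v = E.cls n ⟨v, hv⟩ :=
  (E.exists_symbol n).choose_spec v hv

theorem symbol_eq_zero {m n : ℤ} {v : V} (hv : v ∈ E.space m) (h : m < n) :
    E.symbol n v = 0 := by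
  rw [E.symbol_apply (E.mono h.le hv)]
  exact E.cls_eq_zero _ (E.mono (by omega) hv)

theorem opCoeff_mem {n : ℕ} (m : Fin n → ℤ) (d : Fin n → ℤ) (u : Fin n → V)
    (hu : ∀ i, u i ∈ E.space (d i)) {r : ℤ} {w : V} (hw : w ∈ E.space r) :
    opCoeff V m u w ∈ E.space (∑ i, d i + r) := by
  simp only [opCoeff_apply]
  induction n with
  | zero => simpa using hw
  | succ n ih =>
    rw [List.ofFn_succ, List.prod_cons, Module.End.mul_apply, Fin.sum_univ_succ, add_assoc]
    exact E.mode_mem _ (hu 0) (ih _ _ _ fun i => hu i.succ)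

/-- The products of gr are induced by those of V, so taking classes commutes with composing modes,
one factor at a time. The resulting class may be zero. -/
theorem symbol_opCoeff {n : ℕ} (m : Fin n → ℤ) (d : Fin n → ℤ) (u : Fin n → V)
    (hu : ∀ i, u i ∈ E.space (d i)) {r : ℤ} {w : V} (hw : w ∈ E.space r) :
    E.symbol (∑ i, d i + r) (opCoeff V m u w) =
      opCoeff E.Gr m (fun i => E.cls (d i) ⟨u i, hu i⟩) (E.cls r ⟨w, hw⟩) := by
  induction n with
  | zero =>
    rw [E.symbol_apply (E.opCoeff_mem m d u hu hw)]
    simp only [opCoeff_apply, List.ofFn_zero, List.prod_nil, Module.End.one_apply]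
    exact E.cls_congr _ (by simp)
  | succ n ih =>
    have h1 := E.opCoeff_mem (fun i : Fin n => m i.succ) _ _ (fun i => hu i.succ) hw
    have h2 := ih (fun i : Fin n => m i.succ) _ _ (fun i => hu i.succ)
    rw [E.symbol_apply h1] at h2
    rw [E.symbol_apply (E.opCoeff_mem m d u hu hw)]
    simp only [opCoeff_apply] at h1 h2 ⊢
    simp only [List.ofFn_succ, List.prod_cons, Module.End.mul_apply]
    rw [← h2]
    refine Eq.trans ?_ (E.grMode_cls _ _ _).symm
    exact E.cls_congr _ (by rw [Fin.sum_univ_succ, add_assoc])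

/-- The lifted basis of the associated graded space spans each step of a lower truncated
filtration. -/
theorem space_le_span {κ : ℤ → Type*} (c : ∀ n, Module.Basis (κ n) ℂ (E.Piece n))
    (b : ∀ n, κ n → E.space n) (hb : ∀ n k, E.mkPiece n (b n k) = c n k) {r : ℤ}
    (hr : ∀ n, n < r → E.space n = ⊥) (n : ℤ) :
    E.space n ≤ Submodule.span ℂ (Set.range fun i : Σ n, κ n => (b i.1 i.2 : V)) := by
  rcases lt_or_ge n r with h | h
  · simp [hr n h]
  have key : ∀ n : ℤ,
      E.space (n - 1) ≤ Submodule.span ℂ (Set.range fun i : Σ n, κ n => (b i.1 i.2 : V)) →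
      E.space n ≤ Submodule.span ℂ (Set.range fun i : Σ n, κ n => (b i.1 i.2 : V)) := by
    intro n ih v hv
    set x := E.mkPiece n ⟨v, hv⟩ with hx
    -- Subtracting the lift of its class moves `v` into `E (n - 1)`, where the induction hypothesis
    -- applies.
    have h1 : E.mkPiece n (⟨v, hv⟩ - Finsupp.linearCombination ℂ (b n) ((c n).repr x)) = 0 := by
      rw [map_sub, Finsupp.apply_linearCombination, ← hx, sub_eq_zero]
      conv_lhs => rw [← (c n).linearCombination_repr x]
      congr 2
      exact funext fun k => (hb n k).symm
    rw [mkPiece_eq_zero] at h1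
    have h2 := ih h1
    rw [AddSubgroupClass.coe_sub] at h2
    refine (Submodule.sub_mem_iff_left _ ?_).1 h2
    rw [Finsupp.linearCombination_apply, Finsupp.sum, AddSubmonoidClass.coe_finsetSum]
    refine Submodule.sum_mem _ fun k _ => ?_
    exact Submodule.smul_mem _ _ (Submodule.subset_span ⟨⟨n, k⟩, rfl⟩)
  induction n, h using Int.leInduction with
  -- Lower truncation starts the induction: `E (r - 1)` is zero.
  | base => exact key r (by simp [hr (r - 1) (by omega)])
  | succ n _ ih => exact key _ (by simpa using ih)

/-- The leading term argument is used twice: over ℂ, to see that the lifted basis of gr is a basis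
of V, and over the ring of series, to compare the two families attached to these bases. -/
theorem nondegenerate_of_gr {r : ℤ} (hr : ∀ n, n < r → E.space n = ⊥)
    (h : Nondegenerate E.Gr) : Nondegenerate V := by
  let c := fun n => Module.Basis.ofVectorSpace ℂ (E.Piece n)
  choose b hb using fun n k => E.mkPiece_surjective n (c n k)
  let β : Module.Basis (Σ n, _) ℂ E.Gr := DFinsupp.basis c
  have hβ : ∀ i, β i = E.cls i.1 (b i.1 i.2) := by
    intro i
    rw [cls, LinearMap.comp_apply, hb]
    exact DFinsupp.basis_apply_single c i
  have hsym : ∀ i, E.symbol i.1 (b i.1 i.2 : V) = β i := fun i => by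
    rw [hβ, E.symbol_apply (b i.1 i.2).2]
  have hli : LinearIndependent ℂ fun i : Σ n, _ => (b i.1 i.2 : V) :=
    LinearIndependent.of_symbol (fun i => i.1) E.symbol hsym
      (fun i k hk => E.symbol_eq_zero (b i.1 i.2).2 hk) β.linearIndependent
  let b' := Module.Basis.mk hli fun v _ => by
    obtain ⟨n, hn⟩ := E.exhaustive v
    exact E.space_le_span c b hb hr n hn
  have hb' : ∀ i, b' i = b i.1 i.2 := fun i => Module.Basis.mk_apply _ _ i
  intro n hn
  rw [injective_zMap_iff b']
  have hGr := (injective_zMap_iff β).1 (h n hn)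
  -- The degree of a tuple is the sum of the degrees of its entries; the summand 0 is the degree of
  -- the vacuum.
  refine LinearIndependent.of_symbol (fun I => ∑ i, (I i).1 + 0)
    (fun k => HahnModule.mapCoeff (Exponent n) (E.symbol k)) (fun I => ?_) (fun I k hk => ?_) hGr
  · refine HahnModule.ext _ _ (funext fun m => ?_)
    rw [HahnModule.coeff_mapCoeff, coeff_vacuumSeries, coeff_vacuumSeries]
    rw [E.symbol_opCoeff m.get (fun i => (I i).1) (b' ∘ I)
      (fun i => by rw [Function.comp_apply, hb']; exact (b _ _).2) E.vac_mem]
    congr 2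
    funext i
    simp only [Function.comp_apply, hβ, hb']
  · refine HahnModule.ext _ _ (funext fun m => ?_)
    rw [HahnModule.coeff_mapCoeff, coeff_vacuumSeries]
    exact E.symbol_eq_zero (E.opCoeff_mem m.get (fun i => (I i).1) (b' ∘ I)
      (fun i => by rw [Function.comp_apply, hb']; exact (b _ _).2) E.vac_mem) hk

end VertexFiltration

/-! ### Hermite interpolation and substitution of linear forms -/

section Hermite

variable {K σ : Type*} [Field K] [CharZero K] [Fintype σ]

/-- Multiplied by `l!`, the bracket is the value at `x i` of the k-th derivative of tˡ, where `s =
(i, k)`. The hypotheses thus say that a functional built from derivatives at the nodes kills tˡ for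
l < M. -/
theorem sum_iterate_derivative_eval_eq_zero {x : σ → K} {m M : ℕ} {c : σ × Fin m → K}
    (h : ∀ l < M, ∑ s : σ × Fin m, c s * (if (s.2 : ℕ) ≤ l then
      ((l - s.2 : ℕ).factorial : K)⁻¹ * x s.1 ^ (l - s.2 : ℕ) else 0) = 0)
    {p : Polynomial K} (hp : p.natDegree < M) :
    ∑ s : σ × Fin m, c s * (Polynomial.derivative^[s.2] p).eval (x s.1) = 0 := by
  have h1 : ∀ s : σ × Fin m, (Polynomial.derivative^[s.2] p).eval (x s.1) =
      ∑ l ∈ Finset.range M, (p.coeff l * l.factorial) * (if (s.2 : ℕ) ≤ l then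
        ((l - s.2 : ℕ).factorial : K)⁻¹ * x s.1 ^ (l - s.2 : ℕ) else 0) := by
    intro s
    conv_lhs => rw [p.as_sum_range' M hp]
    rw [Polynomial.iterate_derivative_sum, Polynomial.eval_finsetSum]
    refine Finset.sum_congr rfl fun l _ => ?_
    rw [← Polynomial.C_mul_X_pow_eq_monomial, Polynomial.iterate_derivative_C_mul,
      Polynomial.iterate_derivative_X_pow_eq_natCast_mul]
    simp only [Polynomial.eval_mul, Polynomial.eval_C, Polynomial.eval_natCast,
      Polynomial.eval_pow, Polynomial.eval_X]
    split_ifs with hl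
    · have h2 : (l.factorial : K) = (l - s.2 : ℕ).factorial * l.descFactorial s.2 := by
        exact_mod_cast (Nat.factorial_mul_descFactorial hl).symm
      have h3 := Nat.cast_ne_zero (R := K).2 (l - s.2 : ℕ).factorial_ne_zero
      rw [h2]
      field_simp
    · rw [Nat.descFactorial_eq_zero_iff_lt.2 (by omega)]
      simp
  simp_rw [h1, Finset.mul_sum]
  rw [Finset.sum_comm]
  refine Finset.sum_eq_zero fun l hl => ?_
  refine Eq.trans ?_ ((congrArg (p.coeff l * l.factorial * ·) (h l (Finset.mem_range.1 hl))).trans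
    (mul_zero _))
  rw [Finset.mul_sum]
  exact Finset.sum_congr rfl fun s _ => by ring

/-- This is invertibility of the confluent Vandermonde matrix. If `k` is maximal with `c (i, k) ≠
0`, test the functional on (X - xᵢ)ᵏ ∏_{j ≠ i} (X - xⱼ)ᵐ. Derivatives at the other nodes vanish, as
do those at xᵢ of order below `k`, and orders above `k` have coefficient zero. Only the nonzero term
of (i, k) survives. -/
theorem hermite_coeff_eq_zero {x : σ → K} (hx : Function.Injective x) {m M : ℕ}
    (hM : Fintype.card σ * m ≤ M) {c : σ × Fin m → K}
    (h : ∀ l < M, ∑ s : σ × Fin m, c s * (if (s.2 : ℕ) ≤ l then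
      ((l - s.2 : ℕ).factorial : K)⁻¹ * x s.1 ^ (l - s.2 : ℕ) else 0) = 0) : c = 0 := by
  classical
  by_contra hc
  obtain ⟨s₀, hs₀⟩ := Function.ne_iff.1 hc
  obtain ⟨i, k₀⟩ := s₀
  obtain ⟨k, hk, hmax⟩ := Finset.exists_max_image
    (Finset.univ.filter fun k : Fin m => c (i, k) ≠ 0) id ⟨k₀, by simpa using hs₀⟩
  simp only [Finset.mem_filter, Finset.mem_univ, true_and, id] at hk hmax
  set q : Polynomial K := ∏ j ∈ Finset.univ.erase i, (Polynomial.X - Polynomial.C (x j)) ^ m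
  set p : Polynomial K := (Polynomial.X - Polynomial.C (x i)) ^ (k : ℕ) * q with hpdef
  have hq0 : q.eval (x i) ≠ 0 := by
    rw [Polynomial.eval_prod]
    refine Finset.prod_ne_zero_iff.2 fun j hj => ?_
    have : x i - x j ≠ 0 := sub_ne_zero.2 fun e => (Finset.mem_erase.1 hj).1 (hx e).symm
    simpa using fun e => absurd e this
  have hqne : q ≠ 0 := by rintro e; simp [e] at hq0
  have hpne : p ≠ 0 := mul_ne_zero (pow_ne_zero _ (Polynomial.X_sub_C_ne_zero _)) hqne
  -- Since `k < m`, the degree is at most (|σ| - 1)m + k < |σ|m.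
  have hdeg : p.natDegree < M := by
    have h1 : q.natDegree ≤ (Fintype.card σ - 1) * m := by
      refine (Polynomial.natDegree_prod_le _ _).trans ?_
      simp [Polynomial.natDegree_pow, Finset.card_erase_of_mem]
    have h2 : p.natDegree ≤ k + q.natDegree := by
      refine Polynomial.natDegree_mul_le.trans ?_
      simp [Polynomial.natDegree_pow]
    have h3 : (Fintype.card σ - 1) * m + m = Fintype.card σ * m := by
      rw [← Nat.succ_mul, Nat.succ_eq_add_one, Nat.sub_add_cancel (Fintype.card_pos_iff.2 ⟨i⟩)]
    have := k.2
    omega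
  have hmult : p.rootMultiplicity (x i) = k := by
    rw [hpdef, mul_comm, Polynomial.rootMultiplicity_mul_X_sub_C_pow hqne,
      Polynomial.rootMultiplicity_eq_zero hq0, zero_add]
  have hsum := sum_iterate_derivative_eval_eq_zero h hdeg
  rw [Finset.sum_eq_single (i, k)] at hsum
  · refine (mul_ne_zero hk fun h0 => ?_) hsum
    -- In characteristic zero, vanishing of the k-th derivative as well would push the multiplicity
    -- of the root `x i` above `k`.
    have := (Polynomial.lt_rootMultiplicity_iff_isRoot_iterate_derivative (n := k) hpne
      (t := x i)).2 fun j hj => by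
        rcases hj.lt_or_eq with hj | rfl
        · exact Polynomial.isRoot_iterate_derivative_of_lt_rootMultiplicity (by omega)
        · exact h0
    omega
  · rintro ⟨j, l⟩ - hne
    by_cases hj : j = i
    · subst hj
      rcases lt_trichotomy l k with hl | rfl | hl
      · have := Polynomial.isRoot_iterate_derivative_of_lt_rootMultiplicity (p := p) (t := x j)
          (n := l) (by rw [hmult]; exact hl)
        rw [Polynomial.IsRoot.def] at this
        rw [this, mul_zero]
      · exact absurd rfl hne
      · have : c (j, l) = 0 := by
          by_contra h0
          exact absurd (hmax l h0) (not_le.2 hl)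
        rw [this, zero_mul]
    · have hdvd : (Polynomial.X - Polynomial.C (x j)) ^ m ∣ p :=
        (Finset.dvd_prod_of_mem (fun j => (Polynomial.X - Polynomial.C (x j)) ^ m)
          (Finset.mem_erase.2 ⟨hj, Finset.mem_univ j⟩)).mul_left _
      have := Polynomial.isRoot_iterate_derivative_of_lt_rootMultiplicity (p := p) (t := x j)
        (n := l) (l.2.trans_le ((Polynomial.le_rootMultiplicity_iff hpne).2 hdvd))
      rw [Polynomial.IsRoot.def] at this
      rw [this, mul_zero]
  · simp

end Hermite

/-! ### Substituting truncated exponentials for variables -/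

section Substitution

variable {K σ : Type*} [Field K]

/-- The first `M` coefficients of `t ^ k * exp (t * y)`. -/
def truncExp (M : ℕ) (y : K) (k : ℕ) : ℕ →₀ K :=
  ∑ j ∈ Finset.range (M - k), Finsupp.single (k + j) ((j.factorial : K)⁻¹ * y ^ j)

theorem truncExp_apply {M : ℕ} (y : K) (k : ℕ) {l : ℕ} (hl : l < M) :
    truncExp M y k l =
      if k ≤ l then ((l - k).factorial : K)⁻¹ * y ^ (l - k) else 0 := by
  rw [truncExp, Finsupp.finsetSum_apply]
  split_ifs with h
  · rw [Finset.sum_eq_single (l - k)]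
    · rw [Finsupp.single_apply, if_pos (by omega)]
    · intro j _ hj
      rw [Finsupp.single_apply, if_neg (by omega)]
    · intro hl'
      rw [Finset.mem_range] at hl'
      omega
  · refine Finset.sum_eq_zero fun j _ => ?_
    rw [Finsupp.single_apply, if_neg (by omega)]

/-- The coefficients of tᵏ exp(t xᵢ) are the entries of the Hermite system, so these series are
independent already modulo t^M. -/
theorem linearIndependent_truncExp [CharZero K] [Fintype σ] {x : σ → K} (hx : Function.Injective x) {m M : ℕ}
    (hM : Fintype.card σ * m ≤ M) :
    LinearIndependent K fun s : σ × Fin m => truncExp M (x s.1) s.2 := by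
  rw [Fintype.linearIndependent_iff]
  intro c hc s
  refine congrFun (hermite_coeff_eq_zero hx hM fun l hl => ?_) s
  refine Eq.trans ?_ (DFunLike.congr_fun hc l)
  rw [Finsupp.finsetSum_apply]
  refine Finset.sum_congr rfl fun s _ => ?_
  rw [Finsupp.smul_apply, truncExp_apply _ _ hl, smul_eq_mul]

/-- The linear form `∑ₗ cₗ X_(l, a)`. -/
def linearForm (K : Type*) [Field K] {A : Type*} (a : A) :
    (ℕ →₀ K) →ₗ[K] MvPolynomial (ℕ × A) K :=
  Finsupp.linearCombination K fun l => MvPolynomial.X (l, a)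

/-- The substitution `X_(i, k, a) ↦ ∑ⱼ (x i)ʲ / j! X_(k + j, a)`, truncated at `k + j < M`. -/
def expSubst (A : Type*) (x : σ → K) (M : ℕ) :
    MvPolynomial (σ × ℕ × A) K →ₐ[K] MvPolynomial (ℕ × A) K :=
  MvPolynomial.aeval fun s => linearForm K s.2.2 (truncExp M (x s.1) s.2.1)

theorem expSubst_X {A : Type*} (x : σ → K) (M : ℕ) (s : σ × ℕ × A) :
    expSubst A x M (MvPolynomial.X s) = linearForm K s.2.2 (truncExp M (x s.1) s.2.1) :=
  MvPolynomial.aeval_X _ s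

theorem expSubst_C {A : Type*} (x : σ → K) (M : ℕ) (c : K) :
    expSubst A x M (MvPolynomial.C c) = MvPolynomial.C c :=
  (expSubst A x M).commutes c

/-- Only variables with `k < m` occur in `p`. For `M = |σ| m` their images are independent linear
forms, so a linear left inverse `g` on coefficient vectors extends to an algebra map `Θ` that
recovers each of these variables, hence `p`. The bound `M` depends on `p`. -/
theorem exists_expSubst_ne_zero [CharZero K] [Fintype σ] {A : Type*} {x : σ → K} (hx : Function.Injective x)
    (p : MvPolynomial (σ × ℕ × A) K) : ∃ M, expSubst A x M p = 0 → p = 0 := by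
  classical
  obtain ⟨m, hm⟩ : ∃ m, ∀ s ∈ p.vars, s.2.1 < m :=
    ⟨p.vars.sup (fun s => s.2.1) + 1, fun s hs =>
      Nat.lt_succ_of_le (Finset.le_sup (f := fun s : σ × ℕ × A => s.2.1) hs)⟩
  refine ⟨Fintype.card σ * m, fun h => ?_⟩
  have hli := linearIndependent_truncExp hx (m := m) le_rfl
  obtain ⟨g, hg⟩ := LinearMap.exists_leftInverse_of_injective _ (LinearMap.ker_eq_bot.2 hli)
  let B : A → (σ × Fin m →₀ K) →ₗ[K] MvPolynomial (σ × ℕ × A) K := fun a =>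
    Finsupp.linearCombination K fun s => MvPolynomial.X (s.1, s.2, a)
  let Θ : MvPolynomial (ℕ × A) K →ₐ[K] MvPolynomial (σ × ℕ × A) K :=
    MvPolynomial.aeval fun t => B t.2 (g (Finsupp.single t.1 1))
  have hΘ : ∀ a, Θ.toLinearMap ∘ₗ linearForm K a = B a ∘ₗ g := by
    intro a
    ext l : 2
    simp [Θ, linearForm]
  have hX : ∀ s : σ × ℕ × A, s.2.1 < m →
      Θ (expSubst A x (Fintype.card σ * m) (MvPolynomial.X s)) = MvPolynomial.X s := by
    rintro ⟨i, k, a⟩ hk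
    have h1 := LinearMap.congr_fun hg (Finsupp.single (i, ⟨k, hk⟩) 1)
    have h2 := LinearMap.congr_fun (hΘ a) (truncExp (Fintype.card σ * m) (x i) k)
    simp only [LinearMap.comp_apply, Finsupp.linearCombination_single, one_smul,
      LinearMap.id_apply] at h1
    rw [LinearMap.comp_apply, LinearMap.comp_apply, h1] at h2
    rw [expSubst_X]
    refine h2.trans ?_
    simp [B]
  have hp : (Θ.comp (expSubst A x (Fintype.card σ * m))).toRingHom p = RingHom.id _ p := by
    -- `Θ` need not invert the substitution on other variables; agreement on those of `p` is enough.
    refine MvPolynomial.hom_congr_vars ?_ (fun s hs _ => hX s (hm s hs)) rfl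
    ext c
    simp
  have h3 : (Θ.comp (expSubst A x (Fintype.card σ * m))).toRingHom p = 0 := by
    change Θ (expSubst A x (Fintype.card σ * m) p) = 0
    rw [h, map_zero]
  exact hp.symm.trans h3

end Substitution

/-! ### Hahn series with coefficients in a commutative algebra -/

/-- The ring homomorphism of Hahn series obtained by applying a ring homomorphism to all
coefficients. -/
def HahnSeries.mapCoeffRingHom (Γ : Type*) [AddCommGroup Γ] [LinearOrder Γ]
    [IsOrderedCancelAddMonoid Γ] {R S : Type*} [CommRing R] [CommRing S] (f : R →+* S) :
    HahnSeries Γ R →+* HahnSeries Γ S where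
  toFun x := x.map f
  map_one' := HahnSeries.map_one f.toMonoidWithZeroHom
  map_mul' _ _ := HahnSeries.map_mul f.toNonUnitalRingHom
  map_zero' := by ext; simp
  map_add' _ _ := by ext; simp

theorem HahnSeries.coeff_mapCoeffRingHom {Γ : Type*} [AddCommGroup Γ] [LinearOrder Γ]
    [IsOrderedCancelAddMonoid Γ] {R S : Type*} [CommRing R] [CommRing S] (f : R →+* S)
    (x : HahnSeries Γ R) (a : Γ) : (mapCoeffRingHom Γ f x).coeff a = f (x.coeff a) := rfl

/-- For coefficients in an algebra, the scalar action becomes multiplication in a commutative ring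
of series, where ring homomorphisms can be used. -/
theorem HahnModule.of_symm_smul_eq_mul {Γ : Type*} [AddCommGroup Γ] [LinearOrder Γ]
    [IsOrderedCancelAddMonoid Γ] {R : Type*} [CommRing R] [Algebra ℂ R] (f : HahnSeries Γ ℂ)
    (y : HahnModule Γ ℂ R) : (HahnModule.of ℂ).symm (f • y) =
      HahnSeries.mapCoeffRingHom Γ (algebraMap ℂ R) f * (HahnModule.of ℂ).symm y := by
  ext a
  rw [HahnModule.coeff_smul, HahnSeries.coeff_mul_left' f.isPWO_support
    (fun m hm hy => hm (by simp [HahnSeries.coeff_mapCoeffRingHom, hy]))]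
  refine Finset.sum_congr rfl fun m _ => ?_
  rw [Algebra.smul_def, HahnSeries.coeff_mapCoeffRingHom]

/-! ### Exponents of powers of a single variable -/

namespace Exponent

variable {n : ℕ}

/-- The exponent of `xᵢ ^ k`. -/
def axis (i : Fin n) : ℤ →+ Exponent n where
  toFun k := Exponent.mk (Pi.single i k)
  map_zero' := by rw [Pi.single_zero]; rfl
  map_add' k l := by rw [Pi.single_add]; rfl

theorem get_axis (i : Fin n) (k : ℤ) : (axis i k).get = Pi.single i k := rfl

theorem get_sub (a b : Exponent n) (i : Fin n) : (a - b).get i = a.get i - b.get i := rfl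

theorem get_add (a b : Exponent n) (i : Fin n) : (a + b).get i = a.get i + b.get i := rfl

theorem ext_get {a b : Exponent n} (h : ∀ i, a.get i = b.get i) : a = b := funext h

theorem axis_injective (i : Fin n) : Function.Injective (axis i) := fun k l h => by
  simpa [get_axis] using congrArg (fun m : Exponent n => m.get i) h

theorem axis_strictMono (i : Fin n) : StrictMono (axis i) := fun k l h => by
  refine Exponent.lt_iff.2 ⟨i, fun j hj => ?_, by simpa [get_axis] using h⟩
  rw [get_axis, get_axis, Pi.single_eq_of_ne hj.ne', Pi.single_eq_of_ne hj.ne']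

theorem mem_range_axis {i : Fin n} {m : Exponent n} :
    m ∈ Set.range (axis i) ↔ m = axis i (m.get i) :=
  ⟨by rintro ⟨k, rfl⟩; rw [get_axis, Pi.single_eq_same], fun h => ⟨_, h.symm⟩⟩

end Exponent

/-! ### Taylor series -/

section Taylor

variable {R : Type*} [CommRing R] [Algebra ℂ R] (D : Derivation ℂ R R)

/-- The coefficient of `xᵏ` in `exp(x D) a`. -/
def taylorCoeff (k : ℤ) : R →ₗ[ℂ] R := if 0 ≤ k then divPow D k.toNat else 0

theorem derivationMode_apply (k : ℤ) (a b : R) :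
    derivationMode D (-k - 1) a b = taylorCoeff D k a * b := by
  rw [taylorCoeff]
  split_ifs with h
  · rw [show -k - 1 = -1 - (k.toNat : ℤ) by omega, derivationMode_neg]
  · rw [derivationMode_nonneg D (by omega)]
    simp

/-- The ring homomorphism `a ↦ exp(x D) a`. -/
def taylorPowerSeries : R →+* PowerSeries R where
  toFun a := PowerSeries.mk fun k => divPow D k a
  map_one' := by
    ext k
    rw [PowerSeries.coeff_mk, divPow_one, PowerSeries.coeff_one]
  map_mul' a b := by
    ext k
    rw [PowerSeries.coeff_mk, PowerSeries.coeff_mul, divPow_mul,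
      Finset.Nat.sum_antidiagonal_eq_sum_range_succ_mk]
    simp
  map_zero' := by ext; simp
  map_add' a b := by ext; simp

variable {n : ℕ}

/-- The ring homomorphism `a ↦ exp(xᵢ D) a`. -/
def taylor (i : Fin n) : R →+* HahnSeries (Exponent n) R :=
  (HahnSeries.embDomainRingHom (Exponent.axis i) (Exponent.axis_injective i)
    fun _ _ => (Exponent.axis_strictMono i).le_iff_le).comp
    ((HahnSeries.ofPowerSeries ℤ R).comp (taylorPowerSeries D))

theorem taylor_eq_embDomain (i : Fin n) (a : R) :
    taylor D i a = HahnSeries.embDomain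
      (⟨⟨Exponent.axis i, Exponent.axis_injective i⟩,
        (Exponent.axis_strictMono i).le_iff_le⟩ : ℤ ↪o Exponent n)
      (HahnSeries.ofPowerSeries ℤ R (taylorPowerSeries D a)) := rfl

theorem coeff_taylor_axis (i : Fin n) (a : R) (k : ℤ) :
    (taylor D i a).coeff (Exponent.axis i k) = taylorCoeff D k a := by
  rw [taylor_eq_embDomain]
  refine (HahnSeries.embDomain_coeff (a := k)).trans ?_
  rw [taylorCoeff]
  split_ifs with h
  · obtain ⟨k, rfl⟩ := Int.eq_ofNat_of_zero_le h
    exact (HahnSeries.ofPowerSeries_apply_coeff _ k).trans (PowerSeries.coeff_mk k fun k => divPow D k a)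
  · rw [HahnSeries.ofPowerSeries_apply, HahnSeries.embDomain_of_notMem_range]
    · rfl
    · rintro ⟨j, rfl⟩
      exact h (by simp)

theorem coeff_taylor_of_ne (i : Fin n) (a : R) {m : Exponent n}
    (h : m ≠ Exponent.axis i (m.get i)) : (taylor D i a).coeff m = 0 := by
  rw [taylor_eq_embDomain]
  exact HahnSeries.embDomain_of_notMem_range fun hm => h (Exponent.mem_range_axis.1 hm)

/-- The first factor involves only xᵢ and the second does not involve xᵢ, so each monomial splits in
exactly one way. -/
theorem coeff_taylor_mul (i : Fin n) (a : R) {y : HahnSeries (Exponent n) R}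
    (hy : ∀ m, m.get i ≠ 0 → y.coeff m = 0) (m : Exponent n) :
    (taylor D i a * y).coeff m =
      taylorCoeff D (m.get i) a * y.coeff (m - Exponent.axis i (m.get i)) := by
  rw [HahnSeries.coeff_mul, Finset.sum_eq_single
    (Exponent.axis i (m.get i), m - Exponent.axis i (m.get i)), coeff_taylor_axis]
  · rintro ⟨b, c⟩ hbc hne
    rw [Finset.mem_antidiagonal] at hbc
    obtain ⟨hb, hc, rfl⟩ := hbc
    have h1 : b = Exponent.axis i (b.get i) := by
      by_contra h
      exact hb (coeff_taylor_of_ne D i a h)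
    have h2 : c.get i = 0 := by
      by_contra h
      exact hc (hy c h)
    refine absurd ?_ hne
    rw [Exponent.get_add, h2, add_zero, ← h1, add_sub_cancel_left]
  · intro h
    rw [Finset.mem_antidiagonal, not_and_or, not_and_or] at h
    rcases h with h | h | h
    · rw [HahnSeries.mem_support, not_not] at h
      rw [h, zero_mul]
    · rw [HahnSeries.mem_support, not_not] at h
      rw [h, mul_zero]
    · exact absurd (add_sub_cancel _ _) h

/-- Partial products over `s` serve the induction: they do not involve the next variable, as
`coeff_taylor_mul` requires. When `s` is everything the condition is empty. -/
theorem coeff_prod_taylor (u : Fin n → R) (s : Finset (Fin n)) (m : Exponent n) :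
    (∏ i ∈ s, taylor D i (u i)).coeff m =
      if ∀ i ∉ s, m.get i = 0 then ∏ i ∈ s, taylorCoeff D (m.get i) (u i) else 0 := by
  classical
  induction s using Finset.induction_on generalizing m with
  | empty =>
    simp only [Finset.prod_empty, HahnSeries.coeff_one]
    congr 1
    exact propext ⟨by rintro rfl i -; rfl, fun h => Exponent.ext_get fun i => h i (by simp)⟩
  | insert i s hi ih =>
    rw [Finset.prod_insert hi, coeff_taylor_mul, ih, Finset.prod_insert hi, mul_ite, mul_zero]
    · have h1 : ∀ j, j ≠ i → (m - Exponent.axis i (m.get i)).get j = m.get j := fun j hj => by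
        rw [Exponent.get_sub, Exponent.get_axis, Pi.single_eq_of_ne hj, sub_zero]
      have h2 : (m - Exponent.axis i (m.get i)).get i = 0 := by
        rw [Exponent.get_sub, Exponent.get_axis, Pi.single_eq_same, sub_self]
      congr 1
      · refine propext ⟨fun h j hj => ?_, fun h j hj => ?_⟩
        · rw [Finset.mem_insert, not_or] at hj
          rw [← h1 j hj.1, h j hj.2]
        · by_cases hji : j = i
          · rw [hji, h2]
          · rw [h1 j hji, h j (by simp [hji, hj])]
      · congr 1
        refine Finset.prod_congr rfl fun j hj => ?_
        rw [h1 j fun e => hi (e ▸ hj)]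
    · intro m hm
      rw [ih, if_neg fun h => hm (h i hi)]

theorem opCoeff_ofDerivation (m : Fin n → ℤ) (u : Fin n → R) (w : R) :
    @opCoeff R _ _ (NonlocalVertexAlgebra.ofDerivation D) n m u w =
      (∏ i, taylorCoeff D (m i) (u i)) * w := by
  let := NonlocalVertexAlgebra.ofDerivation D
  rw [opCoeff_apply]
  induction n with
  | zero => simp
  | succ n ih =>
    rw [List.ofFn_succ, List.prod_cons, Module.End.mul_apply, ih, Fin.prod_univ_succ, mul_assoc]
    exact derivationMode_apply D _ _ _

/-- All modes are multiplication operators, so the composite of vertex operators is a plain product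
of Taylor series in separate variables. -/
theorem vacuumSeries_ofDerivation (u : Fin n → R) :
    (HahnModule.of ℂ).symm
      (@vacuumSeries R _ _ (NonlocalVertexAlgebra.ofDerivation D) n u) =
        ∏ i, taylor D i (u i) := by
  ext m
  rw [coeff_prod_taylor, if_pos (by simp)]
  exact (opCoeff_ofDerivation D _ _ _).trans (mul_one _)

end Taylor

/-! ### Differential polynomials -/

/-- Polynomials in the variables `X_(k, a)`, where `X_(k, a)` stands for the `k`-th derivative of
the variable `a`. -/
abbrev DiffPoly (A : Type*) : Type _ := MvPolynomial (ℕ × A) ℂ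

namespace DiffPoly

variable (A : Type*)

/-- The derivation with `X_(k, a) ↦ X_(k + 1, a)`. -/
def deriv : Derivation ℂ (DiffPoly A) (DiffPoly A) :=
  MvPolynomial.mkDerivation ℂ fun t => MvPolynomial.X (t.1 + 1, t.2)

instance : NonlocalVertexAlgebra (DiffPoly A) := NonlocalVertexAlgebra.ofDerivation (deriv A)

variable {A}

theorem divPow_X (j k : ℕ) (a : A) : divPow (deriv A) j (MvPolynomial.X (k, a)) =
    (j.factorial : ℂ)⁻¹ • MvPolynomial.X (k + j, a) := by
  rw [divPow, LinearMap.smul_apply]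
  congr 1
  induction j with
  | zero => simp
  | succ j ih =>
    rw [pow_succ', Module.End.mul_apply, ih, Derivation.coeFn_coe, deriv,
      MvPolynomial.mkDerivation_X, add_assoc]

/-- The algebra map that kills the variables `X_(k, a)` with `M ≤ k`. -/
def trunc (A : Type*) (M : ℕ) : DiffPoly A →ₐ[ℂ] DiffPoly A :=
  MvPolynomial.aeval fun t => if t.1 < M then MvPolynomial.X t else 0

variable {n : ℕ}

/-- Polynomials over `ℂ((x₁))⋯((xₙ))` as series with polynomial coefficients. -/
def polyToSeries (A : Type*) (n : ℕ) :
    MvPolynomial (ℕ × A) (HahnSeries (Exponent n) ℂ) →+* HahnSeries (Exponent n) (DiffPoly A) :=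
  MvPolynomial.eval₂Hom (HahnSeries.mapCoeffRingHom (Exponent n) (algebraMap ℂ (DiffPoly A)))
    fun t => HahnSeries.C (MvPolynomial.X t)

/-- The two ways of extracting coefficients commute, so a polynomial over the series can be
recovered from its image. -/
theorem coeff_coeff_polyToSeries (p : MvPolynomial (ℕ × A) (HahnSeries (Exponent n) ℂ))
    (m : Exponent n) (d : ℕ × A →₀ ℕ) :
    ((polyToSeries A n p).coeff m).coeff d = (p.coeff d).coeff m := by
  classical
  induction p using MvPolynomial.induction_on' with
  | add p q hp hq => simp [hp, hq]
  | monomial e f =>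
    have h : polyToSeries A n (MvPolynomial.monomial e f) =
        HahnSeries.mapCoeffRingHom (Exponent n) (algebraMap ℂ (DiffPoly A)) f *
          HahnSeries.C (MvPolynomial.monomial e 1) := by
      rw [polyToSeries, MvPolynomial.coe_eval₂Hom, MvPolynomial.eval₂_monomial,
        MvPolynomial.monomial_eq, map_one, one_mul, Finsupp.prod, Finsupp.prod, map_prod]
      simp only [map_pow]
    rw [h, HahnSeries.C_apply, HahnSeries.coeff_mul_single_zero,
      HahnSeries.coeff_mapCoeffRingHom, MvPolynomial.algebraMap_eq, MvPolynomial.coeff_C_mul,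
      MvPolynomial.coeff_monomial, MvPolynomial.coeff_monomial]
    split_ifs <;> simp

theorem polyToSeries_injective : Function.Injective (polyToSeries A n) := by
  rw [injective_iff_map_eq_zero]
  intro p hp
  ext d m
  rw [← coeff_coeff_polyToSeries, hp]
  simp

/-- The algebra map over `ℂ((x₁))⋯((xₙ))` sending the variable `X_(i, k, a)` to
`exp(xᵢ ∂) X_(k, a)`. -/
def evalTaylor (A : Type*) (n : ℕ) :
    MvPolynomial (Fin n × ℕ × A) (HahnSeries (Exponent n) ℂ) →+*
      HahnSeries (Exponent n) (DiffPoly A) :=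
  MvPolynomial.eval₂Hom (HahnSeries.mapCoeffRingHom (Exponent n) (algebraMap ℂ (DiffPoly A)))
    fun s => taylor (deriv A) s.1 (MvPolynomial.X s.2)

/-- The variable `xᵢ` of `ℂ((x₁))⋯((xₙ))`. -/
def seriesX (i : Fin n) : HahnSeries (Exponent n) ℂ := HahnSeries.single (Exponent.axis i 1) 1

theorem seriesX_pow (i : Fin n) (j : ℕ) :
    seriesX i ^ j = HahnSeries.single (Exponent.axis i j) (1 : ℂ) := by
  rw [seriesX, HahnSeries.single_pow, one_pow, ← map_nsmul, nsmul_one]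

/-- The variables xᵢ are the nodes of the Hermite interpolation, so they must be distinct. -/
theorem seriesX_injective : Function.Injective (seriesX (n := n)) := by
  intro i j h
  have h1 := congrArg (fun f : HahnSeries (Exponent n) ℂ => f.coeff (Exponent.axis i 1)) h
  simp only [seriesX, HahnSeries.coeff_single_same] at h1
  by_contra hij
  rw [HahnSeries.coeff_single_of_ne] at h1
  · exact one_ne_zero h1
  · intro e
    have := congrArg (fun m : Exponent n => m.get i) e
    simp [Exponent.get_axis, hij] at this

/-- Killing the variables of order at least `M` leaves finitely many terms xᵢʲ/j! X_(k + j, a),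
which form a linear form over the series. This links the vertex operators to `expSubst` at the nodes
xᵢ. -/
theorem map_trunc_taylor_X (M : ℕ) (i : Fin n) (k : ℕ) (a : A) :
    HahnSeries.mapCoeffRingHom (Exponent n) (trunc A M).toRingHom
      (taylor (deriv A) i (MvPolynomial.X (k, a))) =
    polyToSeries A n (linearForm _ a (truncExp M (seriesX i) k)) := by
  have h : ∀ j : ℕ, polyToSeries A n (linearForm _ a (Finsupp.single (k + j)
      ((j.factorial : HahnSeries (Exponent n) ℂ)⁻¹ * seriesX i ^ j))) =
      HahnSeries.single (Exponent.axis i j)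
        ((j.factorial : ℂ)⁻¹ • (MvPolynomial.X (k + j, a) : DiffPoly A)) := by
    intro j
    have h1 : (j.factorial : HahnSeries (Exponent n) ℂ)⁻¹ =
        HahnSeries.C ((j.factorial : ℂ)⁻¹) := by
      rw [map_inv₀, map_natCast]
    rw [linearForm, Finsupp.linearCombination_single, MvPolynomial.smul_eq_C_mul, polyToSeries,
      MvPolynomial.coe_eval₂Hom, MvPolynomial.eval₂_mul, MvPolynomial.eval₂_C,
      MvPolynomial.eval₂_X, h1, seriesX_pow, HahnSeries.C_mul_eq_smul]
    ext1
    funext m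
    rw [HahnSeries.C_apply, HahnSeries.coeff_mul_single_zero, HahnSeries.coeff_mapCoeffRingHom,
      HahnSeries.coeff_smul, HahnSeries.coeff_single, HahnSeries.coeff_single]
    split_ifs
    · simp [MvPolynomial.smul_eq_C_mul]
    · simp
  ext1
  funext m
  rw [HahnSeries.coeff_mapCoeffRingHom, truncExp, map_sum, map_sum, HahnSeries.coeff_sum]
  simp_rw [h]
  -- Only exponents of xᵢʲ with j ≥ 0 contribute; negative powers of xᵢ and exponents off the axis
  -- give zero on both sides.
  by_cases hm : ∃ j : ℕ, m = Exponent.axis i j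
  · obtain ⟨j, rfl⟩ := hm
    rw [coeff_taylor_axis, taylorCoeff, if_pos (by omega), Int.toNat_natCast, divPow_X]
    have h2 : (trunc A M).toRingHom ((j.factorial : ℂ)⁻¹ • MvPolynomial.X (k + j, a)) =
        if k + j < M then (j.factorial : ℂ)⁻¹ • (MvPolynomial.X (k + j, a) : DiffPoly A)
          else 0 := by
      refine (map_smul (trunc A M) _ _).trans ?_
      rw [trunc, MvPolynomial.aeval_X, smul_ite, smul_zero]
    rw [h2]
    by_cases hj : k + j < M
    · rw [if_pos hj, Finset.sum_eq_single j, HahnSeries.coeff_single_same]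
      · intro l _ hl
        exact HahnSeries.coeff_single_of_ne fun e =>
          hl (by simpa using (Exponent.axis_injective i e).symm)
      · intro hj'
        rw [Finset.mem_range] at hj'
        omega
    · rw [if_neg hj]
      refine (Finset.sum_eq_zero fun l hl => HahnSeries.coeff_single_of_ne fun e => ?_).symm
      have := Exponent.axis_injective i e
      rw [Finset.mem_range] at hl
      omega
  · rw [Finset.sum_eq_zero fun l _ => HahnSeries.coeff_single_of_ne fun e => hm ⟨l, e⟩]
    by_cases hm' : m = Exponent.axis i (m.get i)
    · rw [hm', coeff_taylor_axis, taylorCoeff, if_neg]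
      · simp
      · intro h0
        exact hm ⟨(m.get i).toNat, by rw [Int.toNat_of_nonneg h0]; exact hm'⟩
    · rw [coeff_taylor_of_ne _ _ _ hm', map_zero]

theorem map_trunc_evalTaylor (M : ℕ)
    (p : MvPolynomial (Fin n × ℕ × A) (HahnSeries (Exponent n) ℂ)) :
    HahnSeries.mapCoeffRingHom (Exponent n) (trunc A M).toRingHom (evalTaylor A n p) =
      polyToSeries A n (expSubst A (seriesX (n := n)) M p) := by
  have h : (HahnSeries.mapCoeffRingHom (Exponent n) (trunc A M).toRingHom).comp
      (evalTaylor A n) = (polyToSeries A n).comp (expSubst A (seriesX (n := n)) M).toRingHom := by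
    refine MvPolynomial.ringHom_ext (fun f => ?_) fun s => ?_
    · rw [RingHom.comp_apply, RingHom.comp_apply, AlgHom.toRingHom_eq_coe (expSubst _ _ _),
        RingHom.coe_coe (expSubst _ _ _),
        expSubst_C, evalTaylor, polyToSeries, MvPolynomial.coe_eval₂Hom,
        MvPolynomial.coe_eval₂Hom, MvPolynomial.eval₂_C, MvPolynomial.eval₂_C]
      ext1
      funext m
      rw [HahnSeries.coeff_mapCoeffRingHom, HahnSeries.coeff_mapCoeffRingHom]
      exact (trunc A M).commutes _
    · obtain ⟨i, k, a⟩ := s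
      rw [RingHom.comp_apply, RingHom.comp_apply, AlgHom.toRingHom_eq_coe (expSubst _ _ _),
        RingHom.coe_coe (expSubst _ _ _), expSubst_X, ← map_trunc_taylor_X, evalTaylor,
        MvPolynomial.coe_eval₂Hom, MvPolynomial.eval₂_X]
  exact RingHom.congr_fun h p

/-- The series exp(xᵢ∂)X_(k, a) are thus algebraically independent over ℂ((x₁))⋯((xₙ)). If `p` maps
to zero, so does every truncation of its image, and a truncation level suited to `p` forces `p = 0`.
-/
theorem evalTaylor_injective : Function.Injective (evalTaylor A n) := by
  rw [injective_iff_map_eq_zero]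
  intro p hp
  have : CharZero (HahnSeries (Exponent n) ℂ) :=
    charZero_of_injective_ringHom (HahnSeries.C_injective (Γ := Exponent n) (R := ℂ))
  obtain ⟨M, hM⟩ := exists_expSubst_ne_zero seriesX_injective p
  refine hM (polyToSeries_injective ?_)
  rw [← map_trunc_evalTaylor, hp, map_zero, map_zero]

/-! ### Nondegeneracy of differential polynomials -/

/-- A product of monomials in `n` disjoint sets of variables. -/
def jointExponent (I : Fin n → ℕ × A →₀ ℕ) : Fin n × ℕ × A →₀ ℕ :=
  ∑ i, (I i).mapDomain (Prod.mk i)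

theorem jointExponent_apply (I : Fin n → ℕ × A →₀ ℕ) (i : Fin n) (t : ℕ × A) :
    jointExponent I (i, t) = I i t := by
  rw [jointExponent, Finsupp.finsetSum_apply, Finset.sum_eq_single i,
    Finsupp.mapDomain_apply (Prod.mk_right_injective i)]
  · intro j _ hj
    refine Finsupp.mapDomain_of_notMem_range _ _ ?_
    rintro ⟨x, hx⟩
    exact hj (congrArg Prod.fst hx)
  · simp

theorem jointExponent_injective :
    Function.Injective (jointExponent (A := A) (n := n)) := fun I J h => by
  funext i
  ext t
  rw [← jointExponent_apply, h, jointExponent_apply]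

/-- The right side is `f` times the vacuum series of the monomials `I i`, so a relation among vacuum
series is the image of one polynomial. -/
theorem evalTaylor_monomial (I : Fin n → ℕ × A →₀ ℕ) (f : HahnSeries (Exponent n) ℂ) :
    evalTaylor A n (MvPolynomial.monomial (jointExponent I) f) =
      HahnSeries.mapCoeffRingHom (Exponent n) (algebraMap ℂ (DiffPoly A)) f *
        ∏ i, taylor (deriv A) i (MvPolynomial.monomial (I i) 1) := by
  classical
  rw [evalTaylor, MvPolynomial.coe_eval₂Hom, MvPolynomial.eval₂_monomial]
  congr 1
  rw [jointExponent, ← Finsupp.prod_finsetSum_index (fun _ => pow_zero _)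
    fun _ _ _ => pow_add _ _ _]
  refine Finset.prod_congr rfl fun i _ => ?_
  rw [Finsupp.prod_mapDomain_index_inj (Prod.mk_right_injective i), MvPolynomial.monomial_eq,
    map_one, one_mul, Finsupp.prod, Finsupp.prod, map_prod]
  simp only [map_pow]

theorem nondegenerate : Nondegenerate (DiffPoly A) := by
  classical
  intro n _
  rw [injective_zMap_iff (MvPolynomial.basisMonomials (ℕ × A) ℂ), linearIndependent_iff']
  intro s g hg
  have h1 : evalTaylor A n (∑ I ∈ s, MvPolynomial.monomial (jointExponent I) (g I)) = 0 := by
    rw [map_sum]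
    refine Eq.trans ?_ (congrArg (HahnModule.of ℂ).symm hg)
    refine Eq.trans (Finset.sum_congr rfl fun I _ => ?_)
      -- `HahnModule.of` is a bare equivalence, so its inverse is repackaged as an additive map to
      -- pass through the sum.
      (map_sum (AddMonoidHom.mk' (HahnModule.of ℂ).symm fun x y => HahnModule.of_symm_add x y)
        _ _).symm
    rw [evalTaylor_monomial, AddMonoidHom.mk'_apply, HahnModule.of_symm_smul_eq_mul]
    congr 1
    refine Eq.trans ?_ (vacuumSeries_ofDerivation (deriv A) _).symm
    simp
  have h2 := evalTaylor_injective (h1.trans (map_zero _).symm)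
  intro I hI
  -- Distinct tuples have distinct joint exponents, so each coefficient `g I` can be read off
  -- separately.
  have h3 := congrArg (MvPolynomial.coeff (jointExponent I)) h2
  rw [MvPolynomial.coeff_sum, Finset.sum_eq_single I, MvPolynomial.coeff_monomial, if_pos rfl,
    MvPolynomial.coeff_zero] at h3
  · exact h3
  · intro J _ hJ
    rw [MvPolynomial.coeff_monomial, if_neg fun e => hJ (jointExponent_injective e)]
  · exact fun h => absurd hI h

end DiffPoly

/-! ### Free commutative differential algebras -/

/-- An algebra isomorphism that intertwines two derivations, as an isomorphism of nonlocal vertex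
algebras. -/
def NonlocalVertexAlgebra.isoOfDerivation {R S : Type*} [CommRing R] [Algebra ℂ R] [CommRing S]
    [Algebra ℂ S] (D : Derivation ℂ R R) (D' : Derivation ℂ S S) (e : R ≃ₐ[ℂ] S)
    (h : ∀ a, e (D a) = D' (e a)) :
    @Iso R S _ _ (NonlocalVertexAlgebra.ofDerivation D) _ _
      (NonlocalVertexAlgebra.ofDerivation D') :=
  letI := NonlocalVertexAlgebra.ofDerivation D
  letI := NonlocalVertexAlgebra.ofDerivation D'
  { e.toLinearEquiv with
    map_vac := map_one e
    map_mode := fun n a b => by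
      have hpow : ∀ (k : ℕ) (a : R), e ((D.toLinearMap ^ k) a) = (D'.toLinearMap ^ k) (e a) := by
        intro k a
        induction k with
        | zero => rfl
        | succ k ih =>
          rw [pow_succ', pow_succ', Module.End.mul_apply, Module.End.mul_apply, ← ih]
          exact h _
      change e (derivationMode D n a b) = derivationMode D' n (e a) (e b)
      rcases lt_or_ge n 0 with hn | hn
      · obtain ⟨k, rfl⟩ : ∃ k : ℕ, n = -1 - k := ⟨(-n - 1).toNat, by omega⟩
        rw [derivationMode_neg, derivationMode_neg, map_mul, divPow, divPow, LinearMap.smul_apply,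
          LinearMap.smul_apply, map_smul, hpow]
      · rw [derivationMode_nonneg D hn, derivationMode_nonneg D' hn, map_zero] }

namespace FCD

variable (U : Type*) [AddCommGroup U] [Module ℂ U]

/-- The basis `∂ᵏ ⊗ u` of `ℂ[∂] ⊗ U`, where `u` runs through a basis of `U`. -/
def genBasis : Module.Basis (ℕ × Module.Basis.ofVectorSpaceIndex ℂ U) ℂ (Polynomial ℂ ⊗[ℂ] U) :=
  (Polynomial.basisMonomials ℂ).tensorProduct (Module.Basis.ofVectorSpace ℂ U)

theorem shift_genBasis (k : ℕ) (a : Module.Basis.ofVectorSpaceIndex ℂ U) :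
    shift U (genBasis U (k, a)) = genBasis U (k + 1, a) := by
  rw [genBasis, Module.Basis.tensorProduct_apply, Module.Basis.tensorProduct_apply, shift,
    LinearMap.rTensor_tmul, LinearMap.mulLeft_apply, Polynomial.coe_basisMonomials]
  simp only [Polynomial.X_mul_monomial]

/-- The identification of `S(ℂ[∂] ⊗ U)` with differential polynomials. -/
def equivDiffPoly : FCD U ≃ₐ[ℂ] DiffPoly (Module.Basis.ofVectorSpaceIndex ℂ U) :=
  SymmetricAlgebra.equivMvPolynomial (genBasis U)

/-- By the Leibniz rule it is enough to compare on generators, and by linearity on the basis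
`genBasis`, where both derivations raise the order by one. -/
theorem equivDiffPoly_deriv (a : FCD U) :
    equivDiffPoly U (deriv U a) = DiffPoly.deriv _ (equivDiffPoly U a) := by
  induction a using SymmetricAlgebra.induction with
  | algebraMap r => simp
  | ι m =>
    have h : (equivDiffPoly U).toLinearMap ∘ₗ SymmetricAlgebra.ι ℂ _ ∘ₗ shift U =
        (DiffPoly.deriv _).toLinearMap ∘ₗ (equivDiffPoly U).toLinearMap ∘ₗ
          SymmetricAlgebra.ι ℂ _ := by
      refine (genBasis U).ext ?_
      rintro ⟨k, a⟩
      simp [shift_genBasis, equivDiffPoly, SymmetricAlgebra.equivMvPolynomial_ι_apply,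
        DiffPoly.deriv]
    rw [deriv_ι]
    exact LinearMap.congr_fun h m
  | mul a b ha hb => simp [ha, hb]
  | add a b ha hb => simp [ha, hb]

theorem nondegenerate : Nondegenerate (FCD U) :=
  Nondegenerate.of_iso
    (NonlocalVertexAlgebra.isoOfDerivation (deriv U) (DiffPoly.deriv _) (equivDiffPoly U)
      (equivDiffPoly_deriv U)) DiffPoly.nondegenerate

end FCD

end

/-! ### The theorem -/

theorem theorem3p16 (V : Type*) [AddCommGroup V] [Module ℂ V] [NonlocalVertexAlgebra V] :
    (∀ E : VertexFiltration V,
        (∃ r : ℤ, ∀ n : ℤ, n < r → E.space n = ⊥) →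
        NonlocalVertexAlgebra.Nondegenerate E.Gr →
        NonlocalVertexAlgebra.Nondegenerate V) ∧
      (Module.rank ℂ V ≤ Cardinal.aleph0 →
        ∀ E : VertexFiltration V,
          (∀ n : ℤ, n < 0 → E.space n = ⊥) →
          ∀ (U : Type*) [AddCommGroup U] [Module ℂ U],
            Nonempty (NonlocalVertexAlgebra.Iso E.Gr (FCD U)) →
            NonlocalVertexAlgebra.Nondegenerate V) := by
  refine ⟨fun E ⟨_, hr⟩ h => E.nondegenerate_of_gr hr h, fun _ E hE U _ _ ⟨e⟩ => ?_⟩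
  -- Vanishing in negative degrees is lower truncation with `r = 0`; nondegeneracy of gr is
  -- transported from `FCD U`.
  exact E.nondegenerate_of_gr hE (NonlocalVertexAlgebra.Nondegenerate.of_iso e
    (FCD.nondegenerate U))
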